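/- Let either $N\ge 2$ and $0<s<1$, or $N=1$ and $0<s<1/2$, and let $0\le\varphi\in L^1(\mathbb R^N)\cap L^\infty(\mathbb R^N)$. Consider the fractional heat equation $$\partial_t v=-(-\Delta)^s v\ \text{ in }\mathbb R^N\times(0,\infty),\qquad v(\cdot,0)=\varphi,$$ where $(-\Delta)^s$ is the Fourier multiplier with symbol $|\xi|^{2s}$. A solution is a function $v$ such that $v(\cdot,t)$ is continuous and integrable for each $t>0$, $\partial_t\hat v(\xi,t)=-|\xi|^{2s}\hat v(\xi,t)$ for all $t>0$ and $\xi\in\mathbb R^N$ ($\hat{\ }$ being the Fourier transform in $x$), and $v(\cdot,t)\to\varphi$ in $L^1(\mathbb R^N)$ as $t\to0^+$. Then the solution exists and is unique for $t>0$, and it is given by $$v(x,t)=\int_{\mathbb R^N}t^{-\frac N{2s}}\mathscr K_s\big(t^{-\frac1{2s}}(x-y)\big)\varphi(y)\,dy,\qquad \mathscr K_s(x)=(2\pi)^{-N}\int_{\mathbb R^N}e^{ix\cdot\xi}e^{-|\xi|^{2s}}\,d\xi .$$ It satisfies $v(x,t)\ge0$ for all $x\in\mathbb R^N$, $t>0$,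 and $v(x,\cdot)\in L^1(0,\infty)$ for every $x\in\mathbb R^N$. Moreover, let $\sigma$ be a measure on $(0,\infty)$ with $\int(1\wedge\tau)\,\sigma(d\tau)<\infty$, and let $(S_t)_{t\ge0}$ be a subordinator (a process starting at $0$ with stationary independent increments and almost surely non-decreasing right-continuous paths) such that $\mathbb E e^{-\lambda S_t}=e^{-t\Phi(\lambda)}$ for $\lambda,t\ge0$, with $\Phi(\lambda)=\int_{(0,\infty)}(1-e^{-\lambda\tau})\,\sigma(d\tau)$. Let $\mathbf k(t)=\sigma((t,\infty))$, let $\mathcal K(\lambda)=\int_0^\infty e^{-\lambda t}\mathbf k(t)\,dt$ be its Laplace transform, let $E_t=\inf\{r\ge0: S_r\ge t\}$, and let $G_t$ be the density of the law of $E_t$. Put $$v^E(x,t)=\int_0^\infty v(x,\tau)\,G_t(\tau)\,d\tau,\qquad \mathbf M_t(v^E(x,t))=\frac1t\int_0^t v^E(x,r)\,dr .$$ Assume that the kernel is admissible: $\lambda\mathcal K(\lambda)\to0$ as $\lambda\to0^+$, and, for some $\varrho\ge0$, the function $L(x)=x^{-\varrho}\mathcal K(x^{-1})$ is slowly varying,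 that is, $L(cx)/L(x)\to1$ as $x\to\infty$ for every $c>0$. If $\varphi$ is not almost everywhere zero, then for every $x\in\mathbb R^N$ $$\mathbf M_t(v^E(x,t))\ \sim\ \frac{\|v(x,\cdot)\|_{L^1(0,\infty)}}{\Gamma(\varrho+1)}\;t^{-1}\mathcal K(t^{-1})\qquad\text{as }t\to\infty,$$ where $f\sim g$ means $f/g\to1$. -/

import Mathlib

open MeasureTheory ProbabilityTheory Filter Set Topology
open scoped FourierTransform NNReal ENNReal

noncomputable section

/-! ### The fractional heat equation `∂ₜ v = -(-Δ)^s v` on `ℝ^N` -/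

/-- The symbol `|2πξ|^{2s}` of `(-Δ)^s` as a Fourier multiplier, for Mathlib's normalisation
`𝓕 f ξ = ∫ e^{-2πi⟨x,ξ⟩} f(x) dx` of the Fourier transform. -/
def fracLaplacianSymbol {N : ℕ} (s : ℝ) (ξ : EuclideanSpace ℝ (Fin N)) : ℝ :=
  (2 * Real.pi * ‖ξ‖) ^ (2 * s)

/-- `v` is a solution of `∂ₜ v = -(-Δ)^s v` in `ℝ^N × (0,∞)` with `v(·,0) = φ`, where `(-Δ)^s` is
the Fourier multiplier with symbol `|2πξ|^{2s}`: at positive times `v(·,t)` is a continuous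
integrable function, the equation holds at each frequency `ξ`,
and the initial datum is attained in `L¹`. -/
structure IsFracHeatSolution {N : ℕ} (s : ℝ) (φ : EuclideanSpace ℝ (Fin N) → ℝ)
    (v : EuclideanSpace ℝ (Fin N) → ℝ → ℝ) : Prop where
  continuous : ∀ t : ℝ, 0 < t → Continuous fun x => v x t
  integrable : ∀ t : ℝ, 0 < t → Integrable fun x => v x t
  equation : ∀ t : ℝ, 0 < t → ∀ ξ : EuclideanSpace ℝ (Fin N),
    HasDerivAt (fun r : ℝ => 𝓕 (fun x => (v x r : ℂ)) ξ)
      (-(fracLaplacianSymbol s ξ : ℂ) * 𝓕 (fun x => (v x t : ℂ)) ξ) t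
  initial : Tendsto (fun t : ℝ => ∫ x, |v x t - φ x|) (𝓝[>] 0) (𝓝 0)

/-- The profile `K_s(x) = (2π)^{-N} ∫ e^{i x·ξ} e^{-|ξ|^{2s}} dξ` of the fractional heat kernel
(the integral is real, as `e^{-|ξ|^{2s}}` is even). -/
def fracHeatProfile {N : ℕ} (s : ℝ) (x : EuclideanSpace ℝ (Fin N)) : ℝ :=
  ((2 * Real.pi) ^ N)⁻¹ * (∫ ξ : EuclideanSpace ℝ (Fin N),
    Complex.exp (Complex.I * (inner ℝ x ξ : ℝ)) * (Real.exp (-‖ξ‖ ^ (2 * s)) : ℝ)).re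

/-- The fractional heat kernel `t^{-N/(2s)} K_s(t^{-1/(2s)} x)`. -/
def fracHeatKernel {N : ℕ} (s : ℝ) (x : EuclideanSpace ℝ (Fin N)) (t : ℝ) : ℝ :=
  t ^ (-(N : ℝ) / (2 * s)) * fracHeatProfile s (t ^ (-1 / (2 * s)) • x)

/-- The fractional heat semigroup `(e^{-t(-Δ)^s} φ)(x)`, the convolution of `φ` with the kernel. -/
def fracHeat {N : ℕ} (s : ℝ) (φ : EuclideanSpace ℝ (Fin N) → ℝ)
    (x : EuclideanSpace ℝ (Fin N)) (t : ℝ) : ℝ :=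
  ∫ y, fracHeatKernel s (x - y) t * φ y

/-! ### Subordinators, their inverses, and kernels -/

/-- `S` is a subordinator on the probability space `(Ω, P)`: it starts at zero, has independent and
stationary increments, and almost all of its paths are non-decreasing and right-continuous. -/
structure IsSubordinator {Ω : Type*} [MeasurableSpace Ω] (P : Measure Ω) (S : ℝ≥0 → Ω → ℝ) :
    Prop where
  measurable : ∀ t, Measurable (S t)
  zero : ∀ᵐ ω ∂P, S 0 ω = 0
  indep : HasIndepIncrements S P
  stationary : ∀ t h : ℝ≥0, IdentDistrib (fun ω => S (t + h) ω - S t ω) (S h) P P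
  monotone : ∀ᵐ ω ∂P, Monotone fun t => S t ω
  rightContinuous : ∀ᵐ ω ∂P, ∀ t, ContinuousWithinAt (fun r => S r ω) (Ici t) t

/-- `σ` is a measure on `(0,∞)` with `∫ (1 ∧ τ) σ(dτ) < ∞`. -/
structure IsSubordinatorLevyMeasure (σ : Measure ℝ) : Prop where
  nonpos : σ (Iic 0) = 0
  finite : ∫⁻ τ, ENNReal.ofReal (min 1 τ) ∂σ < ∞

/-- The Laplace exponent `Φ(p) = ∫_{(0,∞)} (1 - e^{-pτ}) σ(dτ)` of a Lévy measure. -/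
def laplaceExponent (σ : Measure ℝ) (p : ℝ) : ℝ :=
  ∫ τ in Ioi 0, (1 - Real.exp (-p * τ)) ∂σ

/-- The law of `S` has Laplace exponent `Φ` given by `σ`: `E e^{-p S_t} = e^{-t Φ(p)}`, `p ≥ 0`. -/
def HasLevyMeasure {Ω : Type*} [MeasurableSpace Ω] (P : Measure Ω) (S : ℝ≥0 → Ω → ℝ)
    (σ : Measure ℝ) : Prop :=
  ∀ (t : ℝ≥0) (p : ℝ), 0 ≤ p →
    ∫ ω, Real.exp (-p * S t ω) ∂P = Real.exp (-(t : ℝ) * laplaceExponent σ p)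

/-- The kernel `k(t) = σ((t,∞))`. -/
def tailKernel (σ : Measure ℝ) (t : ℝ) : ℝ := (σ (Ioi t)).toReal

/-- The Laplace transform `∫₀^∞ e^{-pt} f(t) dt`. -/
def laplaceTransform (f : ℝ → ℝ) (p : ℝ) : ℝ := ∫ t in Ioi 0, Real.exp (-p * t) * f t

/-- The inverse process `E_t = inf {r ≥ 0 | S_r ≥ t}`. -/
def inverseSubordinator {Ω : Type*} (S : ℝ≥0 → Ω → ℝ) (t : ℝ) (ω : Ω) : ℝ :=
  ((sInf {r : ℝ≥0 | t ≤ S r ω} : ℝ≥0) : ℝ)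

/-- The density `G_t(τ)` of the law of `E_t` with respect to Lebesgue measure. -/
def inverseDensity {Ω : Type*} [MeasurableSpace Ω] (P : Measure Ω) (S : ℝ≥0 → Ω → ℝ)
    (t τ : ℝ) : ℝ :=
  ((P.map (inverseSubordinator S t)).rnDeriv volume τ).toReal

/-- The subordination `f^E(t) = ∫₀^∞ f(τ) G_t(τ) dτ` of a function of time. -/
def subordination {Ω : Type*} [MeasurableSpace Ω] (P : Measure Ω) (S : ℝ≥0 → Ω → ℝ)
    (f : ℝ → ℝ) (t : ℝ) : ℝ :=
  ∫ τ in Ioi 0, f τ * inverseDensity P S t τ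

/-- The Cesàro mean `(1/t) ∫₀^t f(r) dr`. -/
def cesaroMean (f : ℝ → ℝ) (t : ℝ) : ℝ := t⁻¹ * ∫ r in (0 : ℝ)..t, f r

/-- `L` is slowly varying at infinity: `L(cx)/L(x) → 1` as `x → ∞`, for each `c > 0`. -/
def IsSlowlyVarying (L : ℝ → ℝ) : Prop :=
  ∀ c : ℝ, 0 < c → Tendsto (fun x => L (c * x) / L x) atTop (𝓝 1)

end

/-! The proof has a time half, valid for any nonnegative integrable function `f` of time with
positive integral, and a space half, which shows that $t\mapsto v(x,t)$ is such a function.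

Time half. Almost surely $E_t>r$ exactly when $S_r<t$. In the variable $t$, $P(S_r<t)$ has Laplace
transform $p^{-1}e^{-r\Phi(p)}$, while the convolution of the tail $\mathbf k$ with the law of $S_u$
has transform $p^{-1}\Phi(p)e^{-u\Phi(p)}$. Integrating the latter over $u>r$ gives the former, so
by uniqueness of Laplace transforms the convolution is the density of $E_t$ for almost every $t$,
which suffices because the Cesàro mean integrates in $t$. Tonelli then gives $f^E$ the transform
$\mathcal K(p)\int_0^\infty e^{-\tau\Phi(p)}f(\tau)\,d\tau$ with $\mathcal K(p)=\Phi(p)/p$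
(`laplaceTransform_subordination`). Admissibility says $\Phi(p)=p\,\mathcal K(p)\to0$, so the
transform is asymptotic to $\|f\|_{L^1}\mathcal K(p)$ and regularly varying of index $-\varrho$ at
$0$. `karamata_tauberian` converts this into the growth of $\int_0^t f^E$. It is proved by moments:
Laplace transforms at integer multiples of $p$ are moments in $e^{-u}$, Weierstrass approximation
passes to continuous test functions, and monotonicity of the primitive recovers its value at a
point.

Space half. The key fact is that the Fourier transform of $e^{-|\xi|^{2s}}$ is nonnegative. It
follows by subordination to Gaussians: $l^s$ is a limit of functions $\int w(u)(1-e^{-ul})\,du$ with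
$w\ge0$ integrable, and the exponential of minus such a function is a power series with nonnegative
coefficients in a mixture of the $e^{-ul}$; at $l=|\xi|^2$ these are Gaussians. Nonnegativity makes
the heat kernel integrable (Gaussian summation and Fatou), so it has mass one and is an approximate
identity. Thus $v$ is bounded by $\|\varphi\|_\infty$, decays like $t^{-N/(2s)}$, and is integrable
in time because $2s<N$. Uniqueness is a linear ODE at each frequency followed by Fourier inversion.
-/

/-! ### Moments, Laplace transforms and Karamata's theorem -/

/-- Convergence of all moments of a bounded family of weights under a map into `[0,1]` implies
convergence against all continuous functions of that map. -/
lemma tendsto_integral_comp_mul_of_tendsto_moments {ι α : Type*} [MeasurableSpace α]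
    {μ : Measure α} {l : Filter ι} {X : α → ℝ} (hX : Measurable X)
    (hX01 : ∀ᵐ a ∂μ, X a ∈ Icc (0 : ℝ) 1) {w : ι → α → ℝ} {w₀ : α → ℝ} {C : ℝ}
    (hw : ∀ᶠ i in l, Integrable (w i) μ) (hC : ∀ᶠ i in l, ∫ a, |w i a| ∂μ ≤ C)
    (hw₀ : Integrable w₀ μ)
    (hmom : ∀ n : ℕ, Tendsto (fun i => ∫ a, X a ^ n * w i a ∂μ) l (𝓝 (∫ a, X a ^ n * w₀ a ∂μ)))
    {h : ℝ → ℝ} (hm : Measurable h) (hc : ContinuousOn h (Icc 0 1)) :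
    Tendsto (fun i => ∫ a, h (X a) * w i a ∂μ) l (𝓝 (∫ a, h (X a) * w₀ a ∂μ)) := by
  have hbdd : ∀ q : ℝ → ℝ, Measurable q → ContinuousOn q (Icc 0 1) → ∀ f : α → ℝ,
      Integrable f μ → Integrable (fun a => q (X a) * f a) μ := by
    intro q hq hqc f hf
    obtain ⟨B, hB⟩ := isCompact_Icc.exists_bound_of_continuousOn hqc
    exact hf.bdd_mul (c := B) (hq.comp hX).aestronglyMeasurable
      (by filter_upwards [hX01] with a ha using hB _ ha)
  have hpoly : ∀ q : Polynomial ℝ, Tendsto (fun i => ∫ a, q.eval (X a) * w i a ∂μ) l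
      (𝓝 (∫ a, q.eval (X a) * w₀ a ∂μ)) := by
    intro q
    have key : ∀ f : α → ℝ, Integrable f μ → ∫ a, q.eval (X a) * f a ∂μ =
        ∑ n ∈ Finset.range (q.natDegree + 1), q.coeff n * ∫ a, X a ^ n * f a ∂μ := by
      intro f hf
      simp_rw [Polynomial.eval_eq_sum_range, Finset.sum_mul, mul_assoc]
      rw [integral_finsetSum]
      · simp_rw [integral_const_mul]
      · intro n _
        exact (hbdd (fun x => x ^ n) (by fun_prop) (by fun_prop) f hf).const_mul _
    rw [key _ hw₀]
    refine (tendsto_finsetSum _ fun n _ => (hmom n).const_mul (q.coeff n)).congr' ?_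
    filter_upwards [hw] with i hi using (key _ hi).symm
  have hq_bound : ∀ (q : Polynomial ℝ) (ε : ℝ), (∀ x ∈ Icc (0 : ℝ) 1, |q.eval x - h x| < ε) →
      ∀ f : α → ℝ, Integrable f μ → |∫ a, h (X a) * f a ∂μ - ∫ a, q.eval (X a) * f a ∂μ| ≤
        ε * ∫ a, |f a| ∂μ := by
    intro q ε hq f hf
    rw [← integral_sub (hbdd h hm hc f hf) (hbdd q.eval (by fun_prop) (by fun_prop) f hf),
      ← integral_const_mul, ← Real.norm_eq_abs]
    refine norm_integral_le_of_norm_le (hf.abs.const_mul ε) ?_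
    filter_upwards [hX01] with a ha
    rw [← sub_mul, norm_mul, Real.norm_eq_abs, abs_sub_comm]
    exact mul_le_mul_of_nonneg_right (hq _ ha).le (abs_nonneg _)
  rw [Metric.tendsto_nhds]
  intro ε hε
  -- A Weierstrass polynomial within $\varepsilon/(2D)$ of `h` costs at most $\varepsilon/2$ for the
  -- two weights together, since `D` exceeds the sum of their $L^1$ bounds. The summand 1 only keeps
  -- `D` positive.
  set D : ℝ := |C| + ∫ a, |w₀ a| ∂μ + 1 with hD
  have hI0 : 0 ≤ ∫ a, |w₀ a| ∂μ := integral_nonneg fun _ => abs_nonneg _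
  have hDpos : 0 < D := by positivity
  have hη : 0 < ε / (2 * D) := by positivity
  obtain ⟨q, hq⟩ := exists_polynomial_near_of_continuousOn 0 1 h hc _ hη
  filter_upwards [hw, hC, Metric.tendsto_nhds.1 (hpoly q) (ε / 2) (by positivity)] with i hi hiC hqi
  have h1 := hq_bound q _ hq _ hi
  have h2 := hq_bound q _ hq _ hw₀
  have h3 : ε / (2 * D) * ∫ a, |w i a| ∂μ ≤ ε / (2 * D) * |C| :=
    mul_le_mul_of_nonneg_left (hiC.trans (le_abs_self C)) hη.le
  have h4 : ε / (2 * D) * |C| + ε / (2 * D) * ∫ a, |w₀ a| ∂μ ≤ ε / 2 := by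
    rw [← mul_add]
    calc ε / (2 * D) * (|C| + ∫ a, |w₀ a| ∂μ) ≤ ε / (2 * D) * D :=
          mul_le_mul_of_nonneg_left (by linarith) hη.le
      _ = ε / 2 := by field_simp
  rw [Real.dist_eq] at hqi ⊢
  have h5 := abs_le.1 h1
  have h6 := abs_le.1 h2
  have h7 := abs_lt.1 hqi
  rw [abs_lt]
  constructor <;> linarith [h5.1, h5.2, h6.1, h6.2, h7.1, h7.2]

/-- An integrable function on the half-line all of whose Laplace transforms at natural numbers
vanish is zero almost everywhere. -/
lemma ae_eq_zero_of_laplace_nat_eq_zero {w : ℝ → ℝ} (hw : IntegrableOn w (Ioi 0))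
    (h : ∀ n : ℕ, ∫ t in Ioi 0, Real.exp (-t) ^ n * w t = 0) :
    ∀ᵐ t, t ∈ Ioi (0 : ℝ) → w t = 0 := by
  refine isOpen_Ioi.ae_eq_zero_of_integral_contDiff_smul_eq_zero
    (hw.locallyIntegrableOn) ?_
  intro g hg hgs hgsupp
  have hg0 : ∀ t ≤ 0, g t = 0 := fun t ht => by
    by_contra hne
    exact absurd (hgsupp (subset_tsupport g hne)) (not_lt.2 ht)
  -- The substitution $x=e^{-t}$ turns Laplace transforms at integers into moments on $[0,1]$.
  -- Compact support of `g` makes $g(-\log x)$ vanish near $x=0$.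
  have hcont : ContinuousOn (fun x => g (-Real.log x)) (Icc 0 1) := by
    intro x hx
    rcases hx.1.eq_or_lt with rfl | hx0
    · have hev : ∀ᶠ x in 𝓝[>] (0 : ℝ), g (-Real.log x) = 0 := by
        obtain ⟨R, hR⟩ := hgs.isCompact.isBounded.subset_closedBall 0
        have := (tendsto_neg_atBot_atTop.comp Real.tendsto_log_nhdsGT_zero).eventually_gt_atTop
          (max R 0)
        filter_upwards [this] with y hy
        by_contra hne
        have h1 := hR (subset_tsupport g hne)
        simp only [Function.comp] at hy
        rw [mem_closedBall_zero_iff, Real.norm_eq_abs] at h1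
        exact absurd ((le_abs_self _).trans h1) (not_le.2 ((le_max_left _ _).trans_lt hy))
      -- Since `Real.log 0 = 0`, the value at the endpoint is $g(0)$, which is zero because the
      -- support of `g` lies in $(0,\infty)$.
      have h0 : g (-Real.log 0) = 0 := by simpa using hg0 0 le_rfl
      refine ContinuousWithinAt.mono (t := Ici 0) ?_ Icc_subset_Ici_self
      rw [← continuousWithinAt_Ioi_iff_Ici]
      rw [ContinuousWithinAt, h0]
      exact tendsto_const_nhds.congr' (hev.mono fun y hy => hy.symm)
    · exact (hg.continuous.continuousAt.comp (Real.continuousAt_log hx0.ne').neg).continuousWithinAt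
  -- A constant family along a `pure` filter: its limit against every test function is both its own
  -- value and, by the vanishing moments, zero.
  have key := tendsto_integral_comp_mul_of_tendsto_moments (μ := volume.restrict (Ioi (0 : ℝ)))
    (l := (pure () : Filter Unit))
    (X := fun t => Real.exp (-t)) (w := fun _ => w) (w₀ := fun _ => 0) (C := ∫ t in Ioi 0, |w t|)
    (by fun_prop)
    (by
      filter_upwards [ae_restrict_mem measurableSet_Ioi] with t ht
      exact ⟨(Real.exp_pos _).le, Real.exp_le_one_iff.2 (by simpa using (mem_Ioi.1 ht).le)⟩)
    (.of_forall fun _ => hw) (by simp) (integrable_zero _ _ _)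
    (by intro n; simp [h n])
    (h := fun x => g (-Real.log x))
    (hg.continuous.measurable.comp Real.measurable_log.neg) hcont
  have h2 := tendsto_nhds_unique key (tendsto_pure_nhds _ _)
  simp only [Real.log_exp, neg_neg, mul_zero, integral_zero] at h2
  rw [← h2.symm, ← setIntegral_eq_integral_of_forall_compl_eq_zero (s := Ioi 0)]
  · simp [smul_eq_mul]
  · intro t ht
    simp [hg0 t (not_lt.1 ht)]

/-- Fubini on $\{r\le t\}$, with $\int_r^\infty e^{-pt}\,dt=e^{-pr}/p$. This lets the Tauberian
argument work with the monotone primitive of `f`. -/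
lemma integrableOn_exp_mul_primitive {f : ℝ → ℝ} {p : ℝ} (hp : 0 < p)
    (hint : IntegrableOn (fun t => Real.exp (-p * t) * f t) (Ioi 0)) :
    IntegrableOn (fun t => Real.exp (-p * t) * ∫ r in Ioc 0 t, f r) (Ioi 0) ∧
    ∫ t in Ioi 0, Real.exp (-p * t) * ∫ r in Ioc 0 t, f r = laplaceTransform f p / p := by
  have hfm : AEStronglyMeasurable f (volume.restrict (Ioi 0)) := by
    have h1 := (Continuous.aestronglyMeasurable (μ := volume.restrict (Ioi (0 : ℝ)))
      (f := fun t : ℝ => Real.exp (p * t)) (by fun_prop)).mul hint.aestronglyMeasurable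
    refine h1.congr (.of_forall fun t => ?_)
    simp only [Pi.mul_apply]
    rw [← mul_assoc, ← Real.exp_add]
    simp
  set F : ℝ × ℝ → ℝ := fun z => (Ici z.2).indicator (fun t => Real.exp (-p * t)) z.1 * f z.2 with hF
  have hexp : ∀ r : ℝ, 0 < r → ∫ t in Ioi 0, (Ici r).indicator (fun t => Real.exp (-p * t)) t =
      p⁻¹ * Real.exp (-p * r) := by
    intro r hr
    rw [setIntegral_indicator measurableSet_Ici, inter_eq_right.2 (Ici_subset_Ioi.2 hr),
      integral_Ici_eq_integral_Ioi, integral_exp_mul_Ioi (neg_lt_zero.2 hp)]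
    field_simp
  have hset : MeasurableSet {z : ℝ × ℝ | z.2 ≤ z.1} := measurableSet_le measurable_snd measurable_fst
  have hFm : AEStronglyMeasurable F
      ((volume.restrict (Ioi (0 : ℝ))).prod (volume.restrict (Ioi (0 : ℝ)))) := by
    refine AEStronglyMeasurable.mul ?_ hfm.comp_snd
    have : (fun z : ℝ × ℝ => (Ici z.2).indicator (fun t => Real.exp (-p * t)) z.1) =
        {z : ℝ × ℝ | z.2 ≤ z.1}.indicator (fun z => Real.exp (-p * z.1)) := by
      ext z; simp [indicator]
    rw [this]
    exact ((Measurable.indicator (by fun_prop) hset)).aestronglyMeasurable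
  have hFint : Integrable F
      ((volume.restrict (Ioi (0 : ℝ))).prod (volume.restrict (Ioi (0 : ℝ)))) := by
    rw [integrable_prod_iff' hFm]
    constructor
    · filter_upwards with r
      have h1 : Integrable (fun t => (Ici r).indicator (fun t => Real.exp (-p * t)) t)
          (volume.restrict (Ioi 0)) :=
        (integrableOn_exp_mul_Ioi (neg_lt_zero.2 hp) 0).indicator measurableSet_Ici
      exact h1.mul_const (f r)
    · have h2 := (hint.norm).const_mul p⁻¹
      refine h2.congr ?_
      filter_upwards [ae_restrict_mem measurableSet_Ioi] with r hr
      simp only [hF, norm_mul, integral_mul_const]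
      rw [Real.norm_of_nonneg (Real.exp_pos _).le, ← mul_assoc, ← hexp r hr]
      congr 2
      ext t
      rw [Real.norm_of_nonneg (indicator_nonneg (fun _ _ => (Real.exp_pos _).le) _)]
  have hinner : ∀ t ∈ Ioi (0 : ℝ), ∫ r in Ioi 0, F (t, r) =
      Real.exp (-p * t) * ∫ r in Ioc 0 t, f r := by
    intro t ht
    rw [← integral_const_mul, ← Ioi_inter_Iic, ← setIntegral_indicator measurableSet_Iic]
    congr 1
    ext r
    by_cases hr : r ≤ t <;> simp [hF, hr]
  refine ⟨(hFint.integral_prod_left.congr ?_), ?_⟩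
  · filter_upwards [ae_restrict_mem measurableSet_Ioi] with t ht using hinner t ht
  · rw [← setIntegral_congr_fun measurableSet_Ioi hinner, integral_integral_swap hFint,
      laplaceTransform, ← integral_div]
    refine setIntegral_congr_fun measurableSet_Ioi fun r hr => ?_
    simp only [hF, integral_mul_const]
    rw [hexp r hr]
    field_simp

lemma integrableOn_Ioc_of_laplace {f : ℝ → ℝ} {p : ℝ}
    (hint : IntegrableOn (fun t => Real.exp (-p * t) * f t) (Ioi 0)) (t : ℝ) :
    IntegrableOn f (Ioc 0 t) := by
  have h1 : IntegrableOn (fun t => Real.exp (-p * t) * f t) (Icc 0 t) := by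
    rw [integrableOn_Icc_iff_integrableOn_Ioc]
    exact hint.mono_set Ioc_subset_Ioi_self
  have h2 := h1.continuousOn_mul (g := fun t : ℝ => Real.exp (p * t)) (by fun_prop) isCompact_Icc
  refine (h2.congr_fun (fun t _ => ?_) measurableSet_Icc).mono_set Ioc_subset_Icc_self
  rw [← mul_assoc, ← Real.exp_add]
  simp

/-- A continuous bump, supported on `[e^{-b}, e^{-a}]`. -/
noncomputable def expBump (a b x : ℝ) : ℝ := max 0 ((x - Real.exp (-b)) * (Real.exp (-a) - x))

lemma continuous_expBump (a b : ℝ) : Continuous (expBump a b) := by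
  unfold expBump; fun_prop

lemma expBump_nonneg (a b x : ℝ) : 0 ≤ expBump a b x := le_max_left _ _

lemma expBump_exp_eq_zero {a b u : ℝ} (hab : a ≤ b) (hu : u ∉ Icc a b) :
    expBump a b (Real.exp (-u)) = 0 := by
  apply max_eq_left
  have hba : Real.exp (-b) ≤ Real.exp (-a) := Real.exp_le_exp.2 (by linarith)
  rw [mem_Icc, not_and_or, not_le, not_le] at hu
  rcases hu with hu | hu
  · have := Real.exp_lt_exp.2 (neg_lt_neg hu)
    nlinarith
  · have := Real.exp_lt_exp.2 (neg_lt_neg hu)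
    nlinarith

lemma integrableOn_expBump_mul (a b : ℝ) {w : ℝ → ℝ} (hw : IntegrableOn w (Ioi 0)) :
    IntegrableOn (fun u => expBump a b (Real.exp (-u)) * w u) (Ioi 0) := by
  obtain ⟨B, hB⟩ := (isCompact_Icc (a := (0 : ℝ)) (b := 1)).exists_bound_of_continuousOn
    (continuous_expBump a b).continuousOn
  refine Integrable.bdd_mul hw (c := B)
    ((continuous_expBump a b).comp (by fun_prop)).aestronglyMeasurable ?_
  filter_upwards [ae_restrict_mem measurableSet_Ioi] with u hu
  exact hB _ ⟨(Real.exp_pos _).le, Real.exp_le_one_iff.2 (by simpa using (mem_Ioi.1 hu).le)⟩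

lemma integral_expBump_pos {a b : ℝ} (ha : 0 < a) (hab : a < b) :
    0 < ∫ u in Ioi 0, expBump a b (Real.exp (-u)) * Real.exp (-u) := by
  have hint := integrableOn_expBump_mul a b (w := fun u => Real.exp (-u))
    (by simpa using integrableOn_exp_mul_Ioi (a := -1) (by norm_num) 0)
  rw [setIntegral_pos_iff_support_of_nonneg_ae _ hint]
  · have : Ioo a b ⊆ (Function.support fun u => expBump a b (Real.exp (-u)) * Real.exp (-u)) ∩
        Ioi 0 := by
      intro u hu
      refine ⟨(mul_pos ?_ (Real.exp_pos _)).ne', ha.trans hu.1⟩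
      refine lt_max_of_lt_right (mul_pos (sub_pos.2 ?_) (sub_pos.2 ?_)) <;>
        apply Real.exp_lt_exp.2 <;> linarith [hu.1, hu.2]
    refine lt_of_lt_of_le ?_ (measure_mono this)
    simp [hab]
  · exact .of_forall fun u => mul_nonneg (expBump_nonneg _ _ _) (Real.exp_pos _).le

/-- The bump lives on $[a,b]$ in the variable $u$, where a monotone function lies between its end
values. This is how weak convergence is turned into bounds at single points. -/
lemma integral_expBump_mul_monotone {a b : ℝ} (ha : 0 < a) (hab : a < b) {m : ℝ → ℝ}
    (hm : MonotoneOn m (Ioi 0)) (hmi : IntegrableOn (fun u => Real.exp (-u) * m u) (Ioi 0)) :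
    m a * (∫ u in Ioi 0, expBump a b (Real.exp (-u)) * Real.exp (-u)) ≤
      ∫ u in Ioi 0, expBump a b (Real.exp (-u)) * (Real.exp (-u) * m u) ∧
    ∫ u in Ioi 0, expBump a b (Real.exp (-u)) * (Real.exp (-u) * m u) ≤
      m b * (∫ u in Ioi 0, expBump a b (Real.exp (-u)) * Real.exp (-u)) := by
  have hint := integrableOn_expBump_mul a b (w := fun u => Real.exp (-u))
    (by simpa using integrableOn_exp_mul_Ioi (a := -1) (by norm_num) 0)
  have hmint := integrableOn_expBump_mul a b hmi
  rw [← integral_const_mul, ← integral_const_mul]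
  constructor
  · refine setIntegral_mono_on (hint.const_mul _) hmint measurableSet_Ioi fun u hu => ?_
    by_cases h : u ∈ Icc a b
    · have h1 := hm ha hu h.1
      have h2 : 0 ≤ expBump a b (Real.exp (-u)) * Real.exp (-u) :=
        mul_nonneg (expBump_nonneg _ _ _) (Real.exp_pos _).le
      nlinarith
    · simp [expBump_exp_eq_zero hab.le h]
  · refine setIntegral_mono_on hmint (hint.const_mul _) measurableSet_Ioi fun u hu => ?_
    by_cases h : u ∈ Icc a b
    · have h1 := hm hu (ha.trans hab) h.2
      have h2 : 0 ≤ expBump a b (Real.exp (-u)) * Real.exp (-u) :=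
        mul_nonneg (expBump_nonneg _ _ _) (Real.exp_pos _).le
      nlinarith
    · simp [expBump_exp_eq_zero hab.le h]

/-- **Karamata's Tauberian theorem**, for a nonnegative density. -/
theorem karamata_tauberian {f : ℝ → ℝ} {ρ : ℝ} (hρ : 0 ≤ ρ) (hf : ∀ t, 0 ≤ f t)
    (hint : ∀ p > 0, IntegrableOn (fun t => Real.exp (-p * t) * f t) (Ioi 0))
    (hpos : ∀ p > 0, 0 < laplaceTransform f p)
    (hlim : ∀ n : ℕ, Tendsto (fun p => laplaceTransform f ((n + 1) * p) / laplaceTransform f p)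
      (𝓝[>] 0) (𝓝 ((n + 1 : ℝ) ^ (-ρ)))) :
    Tendsto (fun p => (∫ r in Ioc 0 p⁻¹, f r) / laplaceTransform f p) (𝓝[>] 0)
      (𝓝 (1 / Real.Gamma (ρ + 1))) := by
  set U : ℝ → ℝ := fun t => ∫ r in Ioc 0 t, f r with hU
  have hUmono : Monotone U := fun x y hxy =>
    setIntegral_mono_set (integrableOn_Ioc_of_laplace (hint 1 one_pos) y)
      (.of_forall hf) (Ioc_subset_Ioc_right hxy).eventuallyLE
  have hU0 : ∀ t, 0 ≤ U t := fun t => integral_nonneg hf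
  set Γ := Real.Gamma (ρ + 1) with hΓ
  have hΓpos : 0 < Γ := Real.Gamma_pos_of_pos (by linarith)
  -- With $t=u/p$, the $n$-th moment of $w_p$ in the variable $e^{-u}$ is $\hat f((n+1)p)/((n+1)\hat
  -- f(p))$. It tends to $(n+1)^{-\rho-1}$, the corresponding moment of $w_0$ by the Gamma integral.
  set w : ℝ → ℝ → ℝ := fun p u => Real.exp (-u) * (U (p⁻¹ * u) / laplaceTransform f p) with hw
  set w₀ : ℝ → ℝ := fun u => Real.exp (-u) * (u ^ ρ / Γ) with hw₀
  have hscale : ∀ (n : ℕ), ∀ p > 0,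
      IntegrableOn (fun u => Real.exp (-u) ^ n * w p u) (Ioi 0) ∧
      ∫ u in Ioi 0, Real.exp (-u) ^ n * w p u =
        (laplaceTransform f ((n + 1) * p) / laplaceTransform f p) / (n + 1) := by
    intro n p hp
    have hq : 0 < (n + 1 : ℝ) * p := by positivity
    obtain ⟨h1, h2⟩ := integrableOn_exp_mul_primitive hq (hint _ hq)
    have heq : ∀ u, Real.exp (-u) ^ n * w p u = (laplaceTransform f p)⁻¹ *
        (fun t => Real.exp (-((n + 1) * p) * t) * U t) (p⁻¹ * u) := by
      intro u
      simp only [hw]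
      rw [← Real.exp_nat_mul, ← mul_assoc, ← Real.exp_add]
      have : -((n + 1) * p) * (p⁻¹ * u) = n * -u + -u := by field_simp; ring
      rw [this]; ring
    simp_rw [heq]
    refine ⟨Integrable.const_mul ?_ _, ?_⟩
    · have := (integrableOn_Ioi_comp_mul_left_iff
        (fun t => Real.exp (-((n + 1) * p) * t) * U t) 0 (inv_pos.2 hp)).2 (by simpa using h1)
      exact this
    · rw [integral_const_mul, integral_comp_mul_left_Ioi
        (fun t => Real.exp (-((n + 1) * p) * t) * U t) 0 (inv_pos.2 hp), mul_zero, h2, smul_eq_mul]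
      field_simp
  have hw₀int : ∀ n : ℕ, IntegrableOn (fun u => Real.exp (-u) ^ n * w₀ u) (Ioi 0) ∧
      ∫ u in Ioi 0, Real.exp (-u) ^ n * w₀ u = (n + 1 : ℝ) ^ (-ρ) / (n + 1) := by
    intro n
    have hn : (0 : ℝ) < n + 1 := by positivity
    have heq : ∀ u, Real.exp (-u) ^ n * w₀ u =
        Γ⁻¹ * (u ^ (ρ + 1 - 1) * Real.exp (-((n + 1) * u))) := by
      intro u
      simp only [hw₀]
      rw [← Real.exp_nat_mul, ← mul_assoc, ← Real.exp_add]
      have : n * -u + -u = -((n + 1) * u) := by ring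
      rw [this, add_sub_cancel_right]; ring
    simp_rw [heq]
    have hval := Real.integral_rpow_mul_exp_neg_mul_Ioi (a := ρ + 1) (by linarith) hn
    constructor
    · refine Integrable.const_mul ?_ _
      -- A non-integrable function has integral zero by convention, which contradicts the positive
      -- value just computed.
      by_contra hni
      have := integral_undef hni
      rw [this] at hval
      exact absurd hval.symm (by positivity)
    · rw [integral_const_mul, hval, one_div, Real.inv_rpow hn.le, Real.rpow_add hn,
        Real.rpow_neg hn.le, Real.rpow_one, ← hΓ]
      field_simp
  have hconv : ∀ a b : ℝ, Tendsto (fun p => ∫ u in Ioi 0, expBump a b (Real.exp (-u)) * w p u)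
      (𝓝[>] 0) (𝓝 (∫ u in Ioi 0, expBump a b (Real.exp (-u)) * w₀ u)) := by
    intro a b
    -- The mass bound 1 is the zeroth moment: $w_p\ge0$ has integral $\hat f(p)/\hat f(p)$.
    refine tendsto_integral_comp_mul_of_tendsto_moments (C := 1) (by fun_prop) ?_ ?_ ?_ ?_ ?_
      (continuous_expBump a b).measurable (continuous_expBump a b).continuousOn
    · filter_upwards [ae_restrict_mem measurableSet_Ioi] with t ht
      exact ⟨(Real.exp_pos _).le, Real.exp_le_one_iff.2 (by simpa using (mem_Ioi.1 ht).le)⟩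
    · filter_upwards [self_mem_nhdsWithin] with p hp
      simpa using! (hscale 0 p hp).1
    · filter_upwards [self_mem_nhdsWithin] with p hp
      have h1 := (hscale 0 p hp).2
      simp only [pow_zero, one_mul, Nat.cast_zero, zero_add, div_one,
        div_self (hpos p hp).ne'] at h1
      rw [← h1]
      refine (integral_congr_ae (.of_forall fun u => ?_)).le
      exact abs_of_nonneg (mul_nonneg (Real.exp_pos _).le (div_nonneg (hU0 _) (hpos p hp).le))
    · simpa using! (hw₀int 0).1
    · intro n
      rw [(hw₀int n).2]
      refine ((hlim n).div_const _).congr' ?_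
      filter_upwards [self_mem_nhdsWithin] with p hp using ((hscale n p hp).2).symm
  have hwsq : ∀ a b : ℝ, 0 < a → a < b → ∀ p > 0,
      U (p⁻¹ * a) / laplaceTransform f p *
        (∫ u in Ioi 0, expBump a b (Real.exp (-u)) * Real.exp (-u)) ≤
        ∫ u in Ioi 0, expBump a b (Real.exp (-u)) * w p u ∧
      ∫ u in Ioi 0, expBump a b (Real.exp (-u)) * w p u ≤ U (p⁻¹ * b) / laplaceTransform f p *
        (∫ u in Ioi 0, expBump a b (Real.exp (-u)) * Real.exp (-u)) := by
    intro a b ha hab p hp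
    refine integral_expBump_mul_monotone ha hab (m := fun u => U (p⁻¹ * u) / laplaceTransform f p)
      ?_ (by simpa using! (hscale 0 p hp).1)
    intro x _ y _ hxy
    exact div_le_div_of_nonneg_right (hUmono (mul_le_mul_of_nonneg_left hxy (inv_pos.2 hp).le))
      (hpos p hp).le
  have hw₀sq : ∀ a b : ℝ, 0 < a → a < b →
      a ^ ρ / Γ * (∫ u in Ioi 0, expBump a b (Real.exp (-u)) * Real.exp (-u)) ≤
        ∫ u in Ioi 0, expBump a b (Real.exp (-u)) * w₀ u ∧
      ∫ u in Ioi 0, expBump a b (Real.exp (-u)) * w₀ u ≤ b ^ ρ / Γ *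
        (∫ u in Ioi 0, expBump a b (Real.exp (-u)) * Real.exp (-u)) := by
    intro a b ha hab
    refine integral_expBump_mul_monotone ha hab (m := fun u => u ^ ρ / Γ)
      ?_ (by simpa using! (hw₀int 0).1)
    intro x hx y _ hxy
    exact div_le_div_of_nonneg_right (Real.rpow_le_rpow (mem_Ioi.1 hx).le hxy hρ) hΓpos.le
  have hcont : Tendsto (fun b : ℝ => b ^ ρ / Γ) (𝓝 1) (𝓝 (1 / Γ)) := by
    have : ContinuousAt (fun b : ℝ => b ^ ρ / Γ) 1 :=
      (Real.continuousAt_rpow_const _ _ (Or.inl one_ne_zero)).div_const _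
    simpa [ContinuousAt] using this
  refine tendsto_order.2 ⟨fun y hy => ?_, fun y hy => ?_⟩
  -- A bump on $[a,1]$ with $a$ close to 1 bounds $U(1/p)/\hat f(p)$ from below, asymptotically by
  -- $a^\rho/\Gamma(\rho+1)$. The upper bound uses $[1,b]$ in the same way.
  · obtain ⟨a, ⟨ha0, ha1⟩, hay⟩ : ∃ a ∈ Ioo (0 : ℝ) 1, y < a ^ ρ / Γ := by
      have h1 := Tendsto.eventually_const_lt hy
        (hcont.mono_left (nhdsWithin_le_nhds (s := Iio (1 : ℝ))))
      have h2 : ∀ᶠ a in 𝓝[<] (1 : ℝ), a ∈ Ioo (0 : ℝ) 1 := Ioo_mem_nhdsLT zero_lt_one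
      obtain ⟨a, h⟩ := (h1.and h2).exists
      exact ⟨a, h.2, h.1⟩
    have hJ := integral_expBump_pos ha0 ha1
    have h1 := (hconv a 1).eventually_const_lt
      (lt_of_lt_of_le (mul_lt_mul_of_pos_right hay hJ) (hw₀sq a 1 ha0 ha1).1)
    filter_upwards [h1, self_mem_nhdsWithin] with p hp hp0
    have h2 := hp.trans_le (hwsq a 1 ha0 ha1 p hp0).2
    rw [mul_one] at h2
    exact lt_of_mul_lt_mul_right h2 hJ.le
  · obtain ⟨b, hb1, hby⟩ : ∃ b > (1 : ℝ), b ^ ρ / Γ < y := by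
      have h1 := Tendsto.eventually_lt_const hy
        (hcont.mono_left (nhdsWithin_le_nhds (s := Ioi (1 : ℝ))))
      obtain ⟨b, h⟩ := (h1.and self_mem_nhdsWithin).exists
      exact ⟨b, h.2, h.1⟩
    have hJ := integral_expBump_pos one_pos hb1
    have h1 := (hconv 1 b).eventually_lt_const
      (lt_of_le_of_lt (hw₀sq 1 b one_pos hb1).2 (mul_lt_mul_of_pos_right hby hJ))
    filter_upwards [h1, self_mem_nhdsWithin] with p hp hp0
    have h2 := (hwsq 1 b one_pos hb1 p hp0).1.trans_lt hp
    rw [mul_one] at h2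
    exact lt_of_mul_lt_mul_right h2 hJ.le

/-! ### Lévy measures and their tails -/

namespace IsSubordinatorLevyMeasure

variable {σ : Measure ℝ}

/-- Markov's inequality for $1\wedge\tau$, which is at least $1\wedge u>0$ on $(u,\infty)$. -/
lemma measure_Ioi_lt_top (hσ : IsSubordinatorLevyMeasure σ) {u : ℝ} (hu : 0 < u) :
    σ (Ioi u) < ∞ := by
  have h1 : ENNReal.ofReal (min 1 u) * σ (Ioi u) ≤ ∫⁻ τ, ENNReal.ofReal (min 1 τ) ∂σ := by
    rw [← setLIntegral_const]
    refine (setLIntegral_mono' measurableSet_Ioi fun x hx => ?_).trans (setLIntegral_le_lintegral _ _)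
    exact ENNReal.ofReal_le_ofReal (min_le_min_left _ (mem_Ioi.1 hx).le)
  by_contra h
  rw [not_lt, top_le_iff] at h
  rw [h, ENNReal.mul_top (by simpa using hu)] at h1
  exact absurd hσ.finite (not_lt.2 h1)

/-- Needed for Tonelli, since `σ` may have infinite mass near 0. -/
lemma sigmaFinite (hσ : IsSubordinatorLevyMeasure σ) : SigmaFinite σ := by
  refine ⟨⟨⟨fun n : ℕ => Iic 0 ∪ Ioi (1 / ((n : ℝ) + 1)), fun _ => trivial, fun n => ?_, ?_⟩⟩⟩
  · refine (measure_union_le _ _).trans_lt ?_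
    rw [hσ.nonpos, zero_add]
    exact hσ.measure_Ioi_lt_top (by positivity)
  · refine eq_univ_of_forall fun x => mem_iUnion.2 ?_
    rcases le_or_gt x 0 with hx | hx
    · exact ⟨0, Or.inl hx⟩
    · obtain ⟨n, hn⟩ := exists_nat_one_div_lt hx
      exact ⟨n, Or.inr hn⟩

lemma integrableOn_one_sub_exp (hσ : IsSubordinatorLevyMeasure σ) {p : ℝ} (hp : 0 ≤ p) :
    IntegrableOn (fun τ => 1 - Real.exp (-p * τ)) (Ioi 0) σ := by
  have h1 : IntegrableOn (fun τ : ℝ => min 1 τ) (Ioi 0) σ := by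
    refine ⟨(by fun_prop : Continuous fun τ : ℝ => min 1 τ).aestronglyMeasurable, ?_⟩
    rw [hasFiniteIntegral_iff_ofReal]
    · exact (setLIntegral_le_lintegral _ _).trans_lt hσ.finite
    · filter_upwards [ae_restrict_mem measurableSet_Ioi] with x hx
      exact le_min zero_le_one (mem_Ioi.1 hx).le
  refine (h1.const_mul (max 1 p)).mono' (by fun_prop) ?_
  filter_upwards [ae_restrict_mem measurableSet_Ioi] with x hx
  have hx : 0 < x := hx
  have h2 : Real.exp (-p * x) ≤ 1 := Real.exp_le_one_iff.2 (by nlinarith)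
  have h3 := Real.add_one_le_exp (-p * x)
  have h4 := Real.exp_pos (-p * x)
  rw [Real.norm_of_nonneg (by linarith)]
  rcases le_total 1 x with h | h
  · rw [min_eq_left h, mul_one]
    exact le_trans (by linarith) (le_max_left 1 p)
  · rw [min_eq_right h]
    have := mul_le_mul_of_nonneg_right (le_max_right 1 p) hx.le
    linarith

/-- Tonelli on $\{t<\tau\}$, with $\int_0^\tau e^{-pt}\,dt=(1-e^{-p\tau})/p$. Stated with
`lintegral` so that it can be composed with further exchanges without integrability conditions. -/
lemma lintegral_exp_mul_tail (hσ : IsSubordinatorLevyMeasure σ) {p : ℝ} (hp : 0 < p) :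
    ∫⁻ t in Ioi 0, ENNReal.ofReal (Real.exp (-p * t)) * σ (Ioi t) =
      ENNReal.ofReal (laplaceExponent σ p / p) := by
  have := hσ.sigmaFinite
  have hset : MeasurableSet {z : ℝ × ℝ | z.1 < z.2} := measurableSet_lt measurable_fst measurable_snd
  have h1 : ∀ t : ℝ, ENNReal.ofReal (Real.exp (-p * t)) * σ (Ioi t) = ∫⁻ τ,
      {z : ℝ × ℝ | z.1 < z.2}.indicator (fun z => ENNReal.ofReal (Real.exp (-p * z.1))) (t, τ) ∂σ := by
    intro t
    rw [← lintegral_indicator_const measurableSet_Ioi]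
    rfl
  simp_rw [h1]
  rw [lintegral_lintegral_swap (by
    exact (Measurable.indicator (by fun_prop) hset).aemeasurable)]
  have h2 : ∀ᵐ τ ∂σ, τ ∈ Ioi (0 : ℝ) := by
    rw [ae_iff]
    have : {a : ℝ | a ∉ Ioi (0 : ℝ)} = Iic 0 := by ext; simp
    rw [this, hσ.nonpos]
  have h3 : ∀ τ ∈ Ioi (0 : ℝ), ∫⁻ t in Ioi 0, {z : ℝ × ℝ | z.1 < z.2}.indicator
      (fun z => ENNReal.ofReal (Real.exp (-p * z.1))) (t, τ) =
      ENNReal.ofReal (p⁻¹ * (1 - Real.exp (-p * τ))) := by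
    intro τ hτ
    have : ∀ t, {z : ℝ × ℝ | z.1 < z.2}.indicator
      (fun z => ENNReal.ofReal (Real.exp (-p * z.1))) (t, τ) =
      (Iio τ).indicator (fun t => ENNReal.ofReal (Real.exp (-p * t))) t := fun t => rfl
    simp_rw [this]
    rw [setLIntegral_indicator measurableSet_Iio, inter_comm, Ioi_inter_Iio,
      setLIntegral_congr Ioo_ae_eq_Ioc,
      ← ofReal_integral_eq_lintegral_ofReal ((Continuous.integrableOn_Ioc (by fun_prop)))
        (.of_forall fun _ => (Real.exp_pos _).le), ← intervalIntegral.integral_of_le (mem_Ioi.1 hτ).le]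
    congr 1
    rw [intervalIntegral.integral_comp_mul_left (fun x => Real.exp x) (by linarith : -p ≠ 0)]
    simp only [integral_exp, smul_eq_mul, mul_zero, Real.exp_zero]
    field_simp
    ring
  rw [lintegral_congr_ae (h2.mono h3), laplaceExponent, div_eq_inv_mul, ← integral_const_mul,
    ofReal_integral_eq_lintegral_ofReal ((hσ.integrableOn_one_sub_exp hp.le).const_mul _)]
  · rw [Measure.restrict_eq_self_of_ae_mem h2]
  · filter_upwards [ae_restrict_mem measurableSet_Ioi] with x hx
    have hx : 0 < x := hx
    have : Real.exp (-p * x) ≤ 1 := Real.exp_le_one_iff.2 (by nlinarith)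
    simp only [Pi.zero_apply]
    have := inv_pos.2 hp
    nlinarith

lemma laplaceExponent_nonneg {p : ℝ} (hp : 0 ≤ p) : 0 ≤ laplaceExponent σ p := by
  refine setIntegral_nonneg measurableSet_Ioi fun x hx => ?_
  have hx : 0 < x := hx
  have : Real.exp (-p * x) ≤ 1 := Real.exp_le_one_iff.2 (by nlinarith)
  linarith

lemma measurable_measure_Ioi : Measurable fun t => σ (Ioi t) :=
  Antitone.measurable fun _ _ h => measure_mono (Ioi_subset_Ioi h)

lemma laplaceTransform_tailKernel (hσ : IsSubordinatorLevyMeasure σ) {p : ℝ} (hp : 0 < p) :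
    laplaceTransform (tailKernel σ) p = laplaceExponent σ p / p := by
  rw [laplaceTransform, integral_eq_lintegral_of_nonneg_ae]
  · rw [← ENNReal.toReal_ofReal (div_nonneg (laplaceExponent_nonneg hp.le) hp.le),
      ← hσ.lintegral_exp_mul_tail hp]
    congr 1
    refine setLIntegral_congr_fun measurableSet_Ioi fun t ht => ?_
    rw [ENNReal.ofReal_mul (Real.exp_pos _).le, tailKernel,
      ENNReal.ofReal_toReal (hσ.measure_Ioi_lt_top ht).ne]
  · exact .of_forall fun t => mul_nonneg (Real.exp_pos _).le ENNReal.toReal_nonneg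
  · refine Measurable.aestronglyMeasurable ?_
    exact (by fun_prop : Measurable fun t : ℝ => Real.exp (-p * t)).mul
      measurable_measure_Ioi.ennreal_toReal

end IsSubordinatorLevyMeasure

/-! ### Uniqueness for Laplace transforms -/

lemma ae_eq_of_lintegral_exp_eq {F₁ F₂ : ℝ → ℝ≥0∞} (h₁ : Measurable F₁) (h₂ : Measurable F₂)
    (hfin : ∀ p > 0, ∫⁻ t in Ioi 0, ENNReal.ofReal (Real.exp (-p * t)) * F₁ t ≠ ∞)
    (heq : ∀ p > 0, ∫⁻ t in Ioi 0, ENNReal.ofReal (Real.exp (-p * t)) * F₁ t =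
      ∫⁻ t in Ioi 0, ENNReal.ofReal (Real.exp (-p * t)) * F₂ t) :
    ∀ᵐ t, t ∈ Ioi (0 : ℝ) → F₁ t = F₂ t := by
  have key : ∀ F : ℝ → ℝ≥0∞, Measurable F →
      (∀ p > 0, ∫⁻ t in Ioi 0, ENNReal.ofReal (Real.exp (-p * t)) * F t ≠ ∞) →
      (∀ᵐ t, t ∈ Ioi (0 : ℝ) → F t < ∞) ∧
      (∀ p > 0, IntegrableOn (fun t => Real.exp (-p * t) * (F t).toReal) (Ioi 0)) ∧
      ∀ p > 0, ∫ t in Ioi 0, Real.exp (-p * t) * (F t).toReal =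
        (∫⁻ t in Ioi 0, ENNReal.ofReal (Real.exp (-p * t)) * F t).toReal := by
    intro F hF hfin
    have hEq : ∀ p t : ℝ, Real.exp (-p * t) * (F t).toReal =
        (ENNReal.ofReal (Real.exp (-p * t)) * F t).toReal := by
      intro p t
      rw [ENNReal.toReal_mul, ENNReal.toReal_ofReal (Real.exp_pos _).le]
    have hmeas : ∀ p : ℝ, Measurable fun t => ENNReal.ofReal (Real.exp (-p * t)) * F t := by
      intro p; fun_prop
    have hlt : ∀ p > 0, ∀ᵐ t ∂(volume.restrict (Ioi (0 : ℝ))),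
        ENNReal.ofReal (Real.exp (-p * t)) * F t < ∞ := fun p hp =>
      ae_lt_top (hmeas p) (hfin p hp)
    refine ⟨?_, fun p hp => ?_, fun p hp => ?_⟩
    · rw [← ae_restrict_iff' measurableSet_Ioi]
      filter_upwards [hlt 1 one_pos] with t ht
      by_contra h
      rw [not_lt, top_le_iff] at h
      rw [h, ENNReal.mul_top (by simpa using Real.exp_pos _)] at ht
      exact lt_irrefl _ ht
    · simp_rw [hEq]
      exact integrable_toReal_of_lintegral_ne_top (hmeas p).aemeasurable (hfin p hp)
    · simp_rw [hEq]
      exact integral_toReal (hmeas p).aemeasurable (hlt p hp)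
  obtain ⟨a1, b1, c1⟩ := key F₁ h₁ hfin
  obtain ⟨a2, b2, c2⟩ := key F₂ h₂ (fun p hp => heq p hp ▸ hfin p hp)
  -- Splitting off one factor $e^{-t}$ makes the difference integrable. Its transform at $n$ is then
  -- that of $F_1-F_2$ at $n+1$, so equality at positive integers is enough.
  have h0 := ae_eq_zero_of_laplace_nat_eq_zero
    (w := fun t => Real.exp (-1 * t) * (F₁ t).toReal - Real.exp (-1 * t) * (F₂ t).toReal)
    ((b1 1 one_pos).sub (b2 1 one_pos)) (by
      intro n
      have hn : (0 : ℝ) < n + 1 := by positivity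
      have : ∀ t, Real.exp (-t) ^ n * (Real.exp (-1 * t) * (F₁ t).toReal -
          Real.exp (-1 * t) * (F₂ t).toReal) = Real.exp (-(n + 1) * t) * (F₁ t).toReal -
          Real.exp (-(n + 1) * t) * (F₂ t).toReal := by
        intro t
        rw [← Real.exp_nat_mul, mul_sub, ← mul_assoc, ← mul_assoc, ← Real.exp_add]
        ring_nf
      simp_rw [this]
      rw [integral_sub (b1 _ hn) (b2 _ hn), c1 _ hn, c2 _ hn, heq _ hn, sub_self])
  filter_upwards [a1, a2, h0] with t t1 t2 t0 ht
  have := t0 ht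
  rw [← mul_sub, mul_eq_zero, or_iff_right (Real.exp_pos _).ne', sub_eq_zero] at this
  exact (ENNReal.toReal_eq_toReal_iff' (t1 ht).ne (t2 ht).ne).1 this

/-! ### The one-dimensional laws of a subordinator -/

section Law

set_option linter.unusedSectionVars false

variable {Ω : Type*} [MeasurableSpace Ω] {P : Measure Ω} [IsProbabilityMeasure P]
  {S : ℝ≥0 → Ω → ℝ} {σ : Measure ℝ}

/-- The law of `S_r`, as a function of the real time `r`. -/
noncomputable def timeLaw (P : Measure Ω) (S : ℝ≥0 → Ω → ℝ) (r : ℝ) : Measure ℝ :=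
  P.map (S r.toNNReal)

namespace IsSubordinator

lemma isProbabilityMeasure_timeLaw (hS : IsSubordinator P S) (r : ℝ) :
    IsProbabilityMeasure (timeLaw P S r) :=
  Measure.isProbabilityMeasure_map (hS.measurable _).aemeasurable

/-- $P(S_r\le a)$ is non-increasing in $r$, and the half-lines $(-\infty,a]$ form a generating
π-system. -/
lemma measurable_timeLaw (hS : IsSubordinator P S) : Measurable (timeLaw P S) := by
  have := hS.isProbabilityMeasure_timeLaw
  refine Measurable.measure_of_isPiSystem_of_isProbabilityMeasure
    (borel_eq_generateFrom_Iic ℝ ▸ BorelSpace.measurable_eq) isPiSystem_Iic ?_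
  rintro _ ⟨a, rfl⟩
  refine Antitone.measurable fun r r' h => ?_
  simp only [timeLaw]
  rw [Measure.map_apply (hS.measurable _) measurableSet_Iic,
    Measure.map_apply (hS.measurable _) measurableSet_Iic]
  refine measure_mono_ae ?_
  filter_upwards [hS.monotone] with ω hω h1
  exact (hω (Real.toNNReal_le_toNNReal h)).trans h1

lemma ae_nonneg (hS : IsSubordinator P S) (r : ℝ≥0) : ∀ᵐ ω ∂P, 0 ≤ S r ω := by
  filter_upwards [hS.monotone, hS.zero] with ω h1 h2
  rw [← h2]
  exact h1 zero_le

lemma ae_nonneg_timeLaw (hS : IsSubordinator P S) (r : ℝ) : ∀ᵐ y ∂(timeLaw P S r), 0 ≤ y :=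
  (ae_map_iff (hS.measurable _).aemeasurable measurableSet_Ici).2 (hS.ae_nonneg _)

lemma integrable_exp (hS : IsSubordinator P S) (r : ℝ≥0) {p : ℝ} (hp : 0 ≤ p) :
    Integrable (fun ω => Real.exp (-p * S r ω)) P := by
  refine Integrable.of_bound (C := 1)
    (by have := hS.measurable r; fun_prop) ?_
  filter_upwards [hS.ae_nonneg r] with ω hω
  rw [Real.norm_of_nonneg (Real.exp_pos _).le]
  exact Real.exp_le_one_iff.2 (by nlinarith)

lemma lintegral_exp_timeLaw (hS : IsSubordinator P S) (hL : HasLevyMeasure P S σ) {r p : ℝ}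
    (hr : 0 ≤ r) (hp : 0 ≤ p) : ∫⁻ y, ENNReal.ofReal (Real.exp (-p * y)) ∂(timeLaw P S r) =
      ENNReal.ofReal (Real.exp (-r * laplaceExponent σ p)) := by
  rw [timeLaw, lintegral_map (by fun_prop) (hS.measurable _),
    ← ofReal_integral_eq_lintegral_ofReal (hS.integrable_exp _ hp)
      (.of_forall fun _ => (Real.exp_pos _).le), hL _ _ hp, Real.coe_toNNReal _ hr]

/-- Paths are almost surely unbounded, since $E e^{-S_m}=e^{-m\Phi(1)}\to0$. This keeps the set
defining $E_t$ nonempty. -/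
lemma ae_forall_exists_le (hS : IsSubordinator P S) (hL : HasLevyMeasure P S σ)
    (hΦ : 0 < laplaceExponent σ 1) : ∀ᵐ ω ∂P, ∀ t : ℝ, ∃ r, t ≤ S r ω := by
  have h : ∀ n : ℕ, ∀ᵐ ω ∂P, ∃ r, (n : ℝ) ≤ S r ω := by
    intro n
    rw [ae_iff]
    push Not
    -- Chernoff's bound: if the path stays below $n$, then $e^{-S_m}\ge e^{-n}$ for every $m$.
    have hb : ∀ m : ℕ, ENNReal.ofReal (Real.exp (-1 * n)) * P {ω | ∀ r, S r ω < n} ≤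
        ENNReal.ofReal (Real.exp (-(m : ℝ) * laplaceExponent σ 1)) := by
      intro m
      rw [← hS.lintegral_exp_timeLaw hL m.cast_nonneg zero_le_one, timeLaw,
        lintegral_map (by fun_prop) (hS.measurable _)]
      refine le_trans ?_ (mul_meas_ge_le_lintegral (by have := hS.measurable; fun_prop)
        (ENNReal.ofReal (Real.exp (-1 * n))))
      refine mul_le_mul_right (measure_mono fun ω hω => ?_) _
      have := hω (m : ℝ).toNNReal
      exact ENNReal.ofReal_le_ofReal (Real.exp_le_exp.2 (by linarith))
    have hlim : Tendsto (fun m : ℕ => ENNReal.ofReal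
        (Real.exp (-(m : ℝ) * laplaceExponent σ 1))) atTop (𝓝 0) := by
      rw [← ENNReal.ofReal_zero]
      refine ENNReal.tendsto_ofReal (Real.tendsto_exp_atBot.comp ?_)
      simp_rw [neg_mul]
      exact tendsto_neg_atTop_atBot.comp (tendsto_natCast_atTop_atTop.atTop_mul_const hΦ)
    have h0 := le_antisymm (ge_of_tendsto' hlim hb) zero_le
    rcases mul_eq_zero.1 h0 with h1 | h1
    · exact absurd (ENNReal.ofReal_eq_zero.1 h1) (not_le.2 (Real.exp_pos _))
    · exact h1
  filter_upwards [ae_all_iff.2 h] with ω hω t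
  obtain ⟨n, hn⟩ := exists_nat_ge t
  obtain ⟨r, hr⟩ := hω n
  exact ⟨r, hn.trans hr⟩

/-- Almost surely `E_t > r` if and only if `S_r < t`. -/
lemma ae_lt_inverseSubordinator_iff (hS : IsSubordinator P S) (hL : HasLevyMeasure P S σ)
    (hΦ : 0 < laplaceExponent σ 1) :
    ∀ᵐ ω ∂P, ∀ t : ℝ, ∀ r : ℝ≥0, (r : ℝ) < inverseSubordinator S t ω ↔ S r ω < t := by
  filter_upwards [hS.ae_forall_exists_le hL hΦ, hS.monotone, hS.rightContinuous]
    with ω hub hmono hrc t r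
  rw [inverseSubordinator, NNReal.coe_lt_coe]
  constructor
  · intro h
    by_contra hle
    have h1 : r ∈ {r : ℝ≥0 | t ≤ S r ω} := not_lt.1 hle
    exact absurd (csInf_le (OrderBot.bddBelow _) h1) (not_le.2 h)
  · intro h
    have h1 : ∀ᶠ r' in 𝓝[>] r, S r' ω < t :=
      ((hrc r).mono Ioi_subset_Ici_self).eventually_lt_const h
    obtain ⟨r', hr', hrr'⟩ := (h1.and self_mem_nhdsWithin).exists
    -- Right-continuity provides $r'>r$ with $S_{r'}<t$, and $r'$ bounds the set from below.
    -- Nonemptiness, from `hub`, matters because the infimum of the empty set would be 0.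
    refine lt_of_lt_of_le (mem_Ioi.1 hrr') (le_csInf (hub t) fun a ha => ?_)
    by_contra hlt
    exact absurd (ha.trans (hmono (not_le.1 hlt).le)) (not_le.2 hr')

lemma aemeasurable_inverseSubordinator (hS : IsSubordinator P S) (hL : HasLevyMeasure P S σ)
    (hΦ : 0 < laplaceExponent σ 1) (t : ℝ) : AEMeasurable (inverseSubordinator S t) P := by
  -- Outside a null set, $E_t$ is the supremum of the rational times $q\ge0$ with $S_q<t$: a
  -- countable supremum of measurable functions.
  refine ⟨fun ω => (⨆ q : ℚ, if S (Real.toNNReal q) ω < t then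
    ((Real.toNNReal q : ℝ≥0) : ℝ≥0∞) else 0).toReal, ?_, ?_⟩
  · refine Measurable.ennreal_toReal (Measurable.iSup fun q => ?_)
    exact Measurable.ite (measurableSet_lt (hS.measurable _) measurable_const)
      measurable_const measurable_const
  · filter_upwards [hS.ae_lt_inverseSubordinator_iff hL hΦ] with ω hω
    have h0 : 0 ≤ inverseSubordinator S t ω := NNReal.coe_nonneg _
    rw [← ENNReal.toReal_ofReal h0]
    congr 1
    refine le_antisymm (le_of_forall_lt fun c hc => ?_) (iSup_le fun q => ?_)
    · obtain ⟨q, hq0, hcq, hq⟩ := ENNReal.lt_iff_exists_rat_btwn.1 hc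
      refine hcq.trans_le (le_trans ?_ (le_iSup _ q))
      rw [if_pos]
      rw [← hω]
      rwa [← ENNReal.ofReal_coe_nnreal, ENNReal.ofReal_lt_ofReal_iff_of_nonneg] at hq
      exact NNReal.coe_nonneg _
    · split_ifs with h
      · rw [← ENNReal.ofReal_coe_nnreal]
        exact ENNReal.ofReal_le_ofReal ((hω t _).2 h).le
      · exact zero_le

end IsSubordinator

/-- The density of `E_t` at `r`, as the convolution of the tail of the Lévy measure with the law
of `S_r`. -/
noncomputable def tailConvolution (P : Measure Ω) (S : ℝ≥0 → Ω → ℝ) (σ : Measure ℝ) (t r : ℝ) :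
    ℝ≥0∞ :=
  ∫⁻ y, (Ioi 0).indicator (fun u => σ (Ioi u)) (t - y) ∂(timeLaw P S r)

lemma measurable_indicator_measure_Ioi :
    Measurable ((Ioi (0 : ℝ)).indicator fun u => σ (Ioi u)) :=
  IsSubordinatorLevyMeasure.measurable_measure_Ioi.indicator measurableSet_Ioi

/-- Joint measurability in time and level, obtained by viewing $r\mapsto$ law of $S_r$ as a Markov
kernel. All later applications of Tonelli rest on it. -/
lemma measurable_tailConvolution (hS : IsSubordinator P S) :
    Measurable fun z : ℝ × ℝ => tailConvolution P S σ z.1 z.2 := by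
  let κ : Kernel (ℝ × ℝ) ℝ := ⟨fun z => timeLaw P S z.2, hS.measurable_timeLaw.comp measurable_snd⟩
  have : IsMarkovKernel κ := ⟨fun z => hS.isProbabilityMeasure_timeLaw z.2⟩
  have hm : Measurable fun z : (ℝ × ℝ) × ℝ =>
      (Ioi 0).indicator (fun u => σ (Ioi u)) (z.1.1 - z.2) :=
    measurable_indicator_measure_Ioi.comp (by fun_prop)
  exact hm.lintegral_kernel_prod_right' (κ := κ)

/-- The Laplace transform of a convolution is a product: the tail contributes $\Phi(p)/p$ and the
law of $S_r$ contributes $e^{-r\Phi(p)}$. -/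
lemma lintegral_exp_mul_tailConvolution (hS : IsSubordinator P S)
    (hσ : IsSubordinatorLevyMeasure σ) (hL : HasLevyMeasure P S σ) {r p : ℝ} (hr : 0 ≤ r)
    (hp : 0 < p) :
    ∫⁻ t in Ioi 0, ENNReal.ofReal (Real.exp (-p * t)) * tailConvolution P S σ t r =
      ENNReal.ofReal (laplaceExponent σ p / p) *
        ENNReal.ofReal (Real.exp (-r * laplaceExponent σ p)) := by
  have := hS.isProbabilityMeasure_timeLaw r
  have hm := measurable_indicator_measure_Ioi (σ := σ)
  have hm2 : Measurable fun z : ℝ × ℝ => (Ioi 0).indicator (fun u => σ (Ioi u)) (z.1 - z.2) :=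
    hm.comp (by fun_prop)
  have h1 : ∀ t : ℝ, ENNReal.ofReal (Real.exp (-p * t)) * tailConvolution P S σ t r =
      ∫⁻ y, ENNReal.ofReal (Real.exp (-p * t)) *
        (Ioi 0).indicator (fun u => σ (Ioi u)) (t - y) ∂(timeLaw P S r) := by
    intro t
    rw [tailConvolution, lintegral_const_mul]
    exact hm2.comp (by fun_prop : Measurable fun y : ℝ => (t, y))
  simp_rw [h1]
  rw [lintegral_lintegral_swap (by
    exact ((by fun_prop : Measurable fun z : ℝ × ℝ => ENNReal.ofReal (Real.exp (-p * z.1))).mul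
      hm2).aemeasurable), ← hS.lintegral_exp_timeLaw hL hr hp.le, ← hσ.lintegral_exp_mul_tail hp,
    ← lintegral_const_mul _ (by fun_prop)]
  refine lintegral_congr_ae ?_
  filter_upwards [hS.ae_nonneg_timeLaw r] with y hy
  -- Because $y\ge0$, the condition $t-y>0$ already forces $t>0$, so the half-line integral becomes
  -- a translate of an integral over the whole line.
  have h2 : ∀ t, (Ioi 0).indicator (fun t => ENNReal.ofReal (Real.exp (-p * t)) *
      (Ioi 0).indicator (fun u => σ (Ioi u)) (t - y)) t =
      (fun u => ENNReal.ofReal (Real.exp (-p * y)) *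
        (Ioi 0).indicator (fun u => ENNReal.ofReal (Real.exp (-p * u)) * σ (Ioi u)) u) (t - y) := by
    intro t
    by_cases h : 0 < t - y
    · have ht : 0 < t := by linarith
      simp only [indicator, mem_Ioi, h, ht, if_true]
      rw [← mul_assoc, ← ENNReal.ofReal_mul (Real.exp_pos _).le, ← Real.exp_add]
      ring_nf
    · simp [indicator, h]
  rw [← lintegral_indicator measurableSet_Ioi]
  rw [lintegral_congr h2, lintegral_sub_right_eq_self (μ := volume)
    (fun u => ENNReal.ofReal (Real.exp (-p * y)) * (Ioi 0).indicator
      (fun u => ENNReal.ofReal (Real.exp (-p * u)) * σ (Ioi u)) u) y, lintegral_const_mul,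
    lintegral_indicator measurableSet_Ioi, mul_comm]
  exact ((by fun_prop : Measurable fun u : ℝ => ENNReal.ofReal (Real.exp (-p * u))).mul
      IsSubordinatorLevyMeasure.measurable_measure_Ioi).indicator measurableSet_Ioi

lemma lintegral_exp_mul_timeLaw_Iio (hS : IsSubordinator P S)
    (hL : HasLevyMeasure P S σ) {r p : ℝ} (hr : 0 ≤ r) (hp : 0 < p) :
    ∫⁻ t in Ioi 0, ENNReal.ofReal (Real.exp (-p * t)) * timeLaw P S r (Iio t) =
      ENNReal.ofReal p⁻¹ * ENNReal.ofReal (Real.exp (-r * laplaceExponent σ p)) := by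
  have := hS.isProbabilityMeasure_timeLaw r
  have hset : MeasurableSet {z : ℝ × ℝ | z.2 < z.1} := measurableSet_lt measurable_snd measurable_fst
  have h1 : ∀ t : ℝ, ENNReal.ofReal (Real.exp (-p * t)) * timeLaw P S r (Iio t) = ∫⁻ y,
      {z : ℝ × ℝ | z.2 < z.1}.indicator (fun z => ENNReal.ofReal (Real.exp (-p * z.1))) (t, y)
        ∂(timeLaw P S r) := by
    intro t
    rw [← lintegral_indicator_const measurableSet_Iio]
    rfl
  simp_rw [h1]
  rw [lintegral_lintegral_swap (by
    exact (Measurable.indicator (by fun_prop) hset).aemeasurable),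
    ← hS.lintegral_exp_timeLaw hL hr hp.le, ← lintegral_const_mul _ (by fun_prop)]
  refine lintegral_congr_ae ?_
  filter_upwards [hS.ae_nonneg_timeLaw r] with y hy
  have : ∀ t, {z : ℝ × ℝ | z.2 < z.1}.indicator
      (fun z => ENNReal.ofReal (Real.exp (-p * z.1))) (t, y) =
      (Ioi y).indicator (fun t => ENNReal.ofReal (Real.exp (-p * t))) t := fun t => rfl
  simp_rw [this]
  rw [setLIntegral_indicator measurableSet_Ioi, inter_eq_left.2 (Ioi_subset_Ioi hy),
    ← ofReal_integral_eq_lintegral_ofReal (integrableOn_exp_mul_Ioi (neg_lt_zero.2 hp) y)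
      (.of_forall fun _ => (Real.exp_pos _).le), integral_exp_mul_Ioi (neg_lt_zero.2 hp),
    ← ENNReal.ofReal_mul (inv_pos.2 hp).le]
  congr 1
  field_simp

end Law

/-! ### Density of the inverse subordinator and transform of a subordinated function -/

section InverseLaw

set_option linter.unusedSectionVars false

variable {Ω : Type*} [MeasurableSpace Ω] {P : Measure Ω} [IsProbabilityMeasure P]
  {S : ℝ≥0 → Ω → ℝ} {σ : Measure ℝ}

/-- Both sides have Laplace transform $p^{-1}e^{-r\Phi(p)}$ in $t$, the right side because
$\int_r^\infty\Phi e^{-u\Phi}\,du=e^{-r\Phi}$. The exceptional null set depends on $r$. -/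
lemma ae_timeLaw_Iio_eq (hS : IsSubordinator P S)
    (hσ : IsSubordinatorLevyMeasure σ) (hL : HasLevyMeasure P S σ)
    (hΦ : ∀ p > 0, 0 < laplaceExponent σ p) {r : ℝ} (hr : 0 ≤ r) :
    ∀ᵐ t, t ∈ Ioi (0 : ℝ) → timeLaw P S r (Iio t) = ∫⁻ u in Ioi r, tailConvolution P S σ t u := by
  have hm := measurable_tailConvolution (σ := σ) hS
  refine ae_eq_of_lintegral_exp_eq ?_ ?_ ?_ ?_
  · exact Monotone.measurable fun _ _ h => measure_mono (Iio_subset_Iio h)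
  · exact hm.lintegral_prod_right'
  · intro p hp
    rw [lintegral_exp_mul_timeLaw_Iio hS hL hr hp]
    exact ENNReal.mul_ne_top ENNReal.ofReal_ne_top ENNReal.ofReal_ne_top
  · intro p hp
    rw [lintegral_exp_mul_timeLaw_Iio hS hL hr hp]
    have h1 : ∀ t : ℝ, ENNReal.ofReal (Real.exp (-p * t)) *
        ∫⁻ u in Ioi r, tailConvolution P S σ t u =
        ∫⁻ u in Ioi r, ENNReal.ofReal (Real.exp (-p * t)) * tailConvolution P S σ t u := by
      intro t
      rw [lintegral_const_mul]
      exact hm.comp (by fun_prop : Measurable fun u : ℝ => (t, u))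
    simp_rw [h1]
    rw [lintegral_lintegral_swap (by
      exact ((by fun_prop : Measurable fun z : ℝ × ℝ =>
        ENNReal.ofReal (Real.exp (-p * z.1))).mul hm).aemeasurable),
      setLIntegral_congr_fun measurableSet_Ioi fun u hu =>
        lintegral_exp_mul_tailConvolution hS hσ hL (hr.trans (mem_Ioi.1 hu).le) hp,
      lintegral_const_mul _ (by fun_prop)]
    have hΦp := hΦ p hp
    have h2 : ∀ u : ℝ, -u * laplaceExponent σ p = -laplaceExponent σ p * u := fun u => by ring
    simp_rw [h2]
    rw [← ofReal_integral_eq_lintegral_ofReal (integrableOn_exp_mul_Ioi (neg_lt_zero.2 hΦp) r)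
      (.of_forall fun _ => (Real.exp_pos _).le), integral_exp_mul_Ioi (neg_lt_zero.2 hΦp),
      ← ENNReal.ofReal_mul (inv_pos.2 hp).le, ← ENNReal.ofReal_mul (div_pos hΦp hp).le]
    congr 1
    field_simp

/-- For almost every `t`, the law of `E_t` has density `tailConvolution P S σ t`. -/
lemma ae_map_inverseSubordinator_eq (hS : IsSubordinator P S)
    (hσ : IsSubordinatorLevyMeasure σ) (hL : HasLevyMeasure P S σ)
    (hΦ : ∀ p > 0, 0 < laplaceExponent σ p) :
    ∀ᵐ t, t ∈ Ioi (0 : ℝ) → P.map (inverseSubordinator S t) =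
      volume.withDensity ((Ioi 0).indicator (tailConvolution P S σ t)) := by
  -- Rational levels give one null set for all of them, and half-lines with rational endpoints
  -- determine a measure. Negative levels are replaced by 0, where $P(S_0<t)=1$.
  have hall : ∀ᵐ t, ∀ q : ℚ, t ∈ Ioi (0 : ℝ) →
      timeLaw P S (max q 0 : ℝ) (Iio t) = ∫⁻ u in Ioi (max q 0 : ℝ), tailConvolution P S σ t u :=
    ae_all_iff.2 fun q => ae_timeLaw_Iio_eq hS hσ hL hΦ (le_max_right _ _)
  filter_upwards [hall] with t ht ht0
  have hEm := hS.aemeasurable_inverseSubordinator hL (hΦ 1 one_pos) t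
  have hprob : IsProbabilityMeasure (P.map (inverseSubordinator S t)) :=
    Measure.isProbabilityMeasure_map hEm
  have hlaw : ∀ r : ℝ≥0, P (inverseSubordinator S t ⁻¹' Ioi r) = timeLaw P S r (Iio t) := by
    intro r
    rw [timeLaw, Measure.map_apply (hS.measurable _) measurableSet_Iio]
    refine measure_congr ?_
    filter_upwards [hS.ae_lt_inverseSubordinator_iff hL (hΦ 1 one_pos)] with ω hω
    have := hω t r
    apply propext
    simpa using! this
  have hdens : ∀ r : ℝ, volume.withDensity ((Ioi 0).indicator (tailConvolution P S σ t)) (Ioi r) =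
      ∫⁻ u in Ioi (max r 0 : ℝ), tailConvolution P S σ t u := by
    intro r
    rw [withDensity_apply _ measurableSet_Ioi, setLIntegral_indicator measurableSet_Ioi,
      Ioi_inter_Ioi, sup_comm]
  have hzero : timeLaw P S 0 (Iio t) = 1 := by
    have := hS.isProbabilityMeasure_timeLaw 0
    rw [timeLaw, Measure.map_apply (hS.measurable _) measurableSet_Iio, ← measure_univ (μ := P)]
    refine measure_congr (eventuallyEq_univ.2 ?_)
    filter_upwards [hS.zero] with ω hω
    simpa [hω] using! ht0
  have hIoi : ∀ q : ℚ, P.map (inverseSubordinator S t) (Ioi (q : ℝ)) =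
      volume.withDensity ((Ioi 0).indicator (tailConvolution P S σ t)) (Ioi (q : ℝ)) := by
    intro q
    rw [Measure.map_apply_of_aemeasurable hEm measurableSet_Ioi, hdens, ← ht q ht0]
    rcases le_or_gt 0 (q : ℝ) with hq | hq
    · have := hlaw ⟨q, hq⟩
      rw [max_eq_left hq]
      exact this
    · rw [max_eq_right hq.le, hzero, ← measure_univ (μ := P)]
      refine congrArg P (eq_univ_of_forall fun ω => ?_)
      exact hq.trans_le (NNReal.coe_nonneg _)
  refine ext_of_generate_finite _ ((BorelSpace.measurable_eq (α := ℝ)).trans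
    Real.borel_eq_generateFrom_Ioi_rat) Real.isPiSystem_Ioi_rat ?_ ?_
  · intro s hs
    simp only [mem_iUnion, mem_singleton_iff] at hs
    obtain ⟨q, rfl⟩ := hs
    exact hIoi q
  · rw [measure_univ, withDensity_apply _ MeasurableSet.univ, Measure.restrict_univ,
      lintegral_indicator measurableSet_Ioi]
    -- Level 0 also shows that the proposed density has total mass one.
    have := ht 0 ht0
    simp only [Rat.cast_zero, max_self] at this
    rw [← this, hzero]

lemma ae_inverseDensity_eq (hS : IsSubordinator P S)
    (hσ : IsSubordinatorLevyMeasure σ) (hL : HasLevyMeasure P S σ)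
    (hΦ : ∀ p > 0, 0 < laplaceExponent σ p) :
    ∀ᵐ t, t ∈ Ioi (0 : ℝ) → ∀ᵐ τ, τ ∈ Ioi (0 : ℝ) →
      inverseDensity P S t τ = (tailConvolution P S σ t τ).toReal := by
  filter_upwards [ae_map_inverseSubordinator_eq hS hσ hL hΦ] with t ht ht0
  have hm : Measurable ((Ioi 0).indicator (tailConvolution P S σ t)) :=
    ((measurable_tailConvolution hS).comp (by fun_prop : Measurable fun u : ℝ => (t, u))).indicator
      measurableSet_Ioi
  filter_upwards [Measure.rnDeriv_withDensity volume hm] with τ hτ hτ0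
  rw [inverseDensity, ht ht0, hτ, indicator_of_mem hτ0]

/-- The Laplace transform of a subordinated function. -/
theorem laplaceTransform_subordination (hS : IsSubordinator P S)
    (hσ : IsSubordinatorLevyMeasure σ) (hL : HasLevyMeasure P S σ)
    (hΦ : ∀ p > 0, 0 < laplaceExponent σ p) {f : ℝ → ℝ} (hf0 : ∀ τ > 0, 0 ≤ f τ)
    (hfi : IntegrableOn f (Ioi 0)) {p : ℝ} (hp : 0 < p) :
    IntegrableOn (fun t => Real.exp (-p * t) * subordination P S f t) (Ioi 0) ∧
    laplaceTransform (subordination P S f) p = laplaceTransform (tailKernel σ) p *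
      ∫ τ in Ioi 0, Real.exp (-τ * laplaceExponent σ p) * f τ := by
  set g := tailConvolution P S σ with hg
  have hm : Measurable fun z : ℝ × ℝ => g z.1 z.2 := measurable_tailConvolution hS
  -- A measurable representative of `f` is required for the exchange of `lintegral`s; it changes no
  -- integral over the half-line.
  set f' := hfi.aestronglyMeasurable.mk f with hf'
  have hf'm : Measurable f' := hfi.aestronglyMeasurable.stronglyMeasurable_mk.measurable
  have hff' : f =ᵐ[volume.restrict (Ioi 0)] f' := hfi.aestronglyMeasurable.ae_eq_mk
  have hf'0 : 0 ≤ᵐ[volume.restrict (Ioi 0)] f' := by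
    filter_upwards [hff', ae_restrict_mem measurableSet_Ioi] with τ h1 h2
    rw [← h1]; exact hf0 τ h2
  have hf'i : IntegrableOn f' (Ioi 0) := Integrable.congr hfi hff'
  set H : ℝ → ℝ≥0∞ := fun t => ∫⁻ τ in Ioi 0, ENNReal.ofReal (f' τ) * g t τ with hH
  have hfg : Measurable fun z : ℝ × ℝ => ENNReal.ofReal (f' z.2) * g z.1 z.2 :=
    (hf'm.comp measurable_snd).ennreal_ofReal.mul hm
  have hHm : Measurable H := hfg.lintegral_prod_right'
  have hexpm : Integrable (fun τ => Real.exp (-τ * laplaceExponent σ p) * f' τ)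
      (volume.restrict (Ioi 0)) := by
    refine hf'i.bdd_mul (c := 1) (by fun_prop) ?_
    filter_upwards [ae_restrict_mem measurableSet_Ioi] with τ hτ
    have hτ : 0 < τ := hτ
    rw [Real.norm_of_nonneg (Real.exp_pos _).le]
    exact Real.exp_le_one_iff.2 (by nlinarith [hΦ p hp])
  have hHL : ∫⁻ t in Ioi 0, ENNReal.ofReal (Real.exp (-p * t)) * H t =
      ENNReal.ofReal (laplaceExponent σ p / p) *
        ENNReal.ofReal (∫ τ in Ioi 0, Real.exp (-τ * laplaceExponent σ p) * f' τ) := by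
    have h1 : ∀ t : ℝ, ENNReal.ofReal (Real.exp (-p * t)) * H t =
        ∫⁻ τ in Ioi 0, ENNReal.ofReal (Real.exp (-p * t)) * (ENNReal.ofReal (f' τ) * g t τ) := by
      intro t
      simp only [hH]
      rw [lintegral_const_mul]
      exact hfg.comp (by fun_prop : Measurable fun u : ℝ => (t, u))
    simp_rw [h1]
    rw [lintegral_lintegral_swap (by
      exact ((by fun_prop : Measurable fun z : ℝ × ℝ =>
        ENNReal.ofReal (Real.exp (-p * z.1))).mul hfg).aemeasurable),
      ofReal_integral_eq_lintegral_ofReal hexpm (by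
        filter_upwards [hf'0] with τ hτ using mul_nonneg (Real.exp_pos _).le hτ),
      ← lintegral_const_mul _ (by fun_prop)]
    refine setLIntegral_congr_fun measurableSet_Ioi fun τ hτ => ?_
    have h2 : ∀ t : ℝ, ENNReal.ofReal (Real.exp (-p * t)) * (ENNReal.ofReal (f' τ) * g t τ) =
        ENNReal.ofReal (f' τ) * (ENNReal.ofReal (Real.exp (-p * t)) * g t τ) := fun t => by ring
    simp_rw [h2]
    rw [lintegral_const_mul, lintegral_exp_mul_tailConvolution hS hσ hL (mem_Ioi.1 hτ).le hp,
      ENNReal.ofReal_mul (Real.exp_pos _).le]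
    · ring
    · exact (by fun_prop : Measurable fun t : ℝ => ENNReal.ofReal (Real.exp (-p * t))).mul
        (hm.comp (by fun_prop : Measurable fun t : ℝ => (t, τ)))
  have hEm : Measurable fun t => ENNReal.ofReal (Real.exp (-p * t)) * H t :=
    (by fun_prop : Measurable fun t : ℝ => ENNReal.ofReal (Real.exp (-p * t))).mul hHm
  have hfin : ∫⁻ t in Ioi 0, ENNReal.ofReal (Real.exp (-p * t)) * H t ≠ ∞ := by
    rw [hHL]; exact ENNReal.mul_ne_top ENNReal.ofReal_ne_top ENNReal.ofReal_ne_top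
  have hfinae := ae_lt_top hEm hfin
  -- The density of $E_t$ is identified only for almost every $t$, which is all that a Laplace
  -- transform sees.
  have hsub : ∀ᵐ t ∂(volume.restrict (Ioi (0 : ℝ))),
      Real.exp (-p * t) * subordination P S f t =
        (ENNReal.ofReal (Real.exp (-p * t)) * H t).toReal := by
    filter_upwards [hfinae, ae_restrict_of_ae (ae_inverseDensity_eq hS hσ hL hΦ),
      ae_restrict_mem measurableSet_Ioi] with t h1 h2 ht
    rw [ENNReal.toReal_mul, ENNReal.toReal_ofReal (Real.exp_pos _).le]
    congr 1
    have hHt : H t ≠ ∞ := by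
      intro h
      rw [h, ENNReal.mul_top (by simpa using Real.exp_pos _)] at h1
      exact lt_irrefl _ h1
    have hfgt : Measurable fun τ => ENNReal.ofReal (f' τ) * g t τ :=
      hfg.comp (by fun_prop : Measurable fun u : ℝ => (t, u))
    rw [subordination]
    simp only [hH]
    rw [← integral_toReal hfgt.aemeasurable (ae_lt_top hfgt hHt)]
    refine integral_congr_ae ?_
    filter_upwards [hff', hf'0, ae_restrict_of_ae (h2 ht), ae_restrict_mem measurableSet_Ioi]
      with τ h3 h4 h5 hτ
    rw [h3, h5 hτ, ENNReal.toReal_mul, ENNReal.toReal_ofReal h4]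
  constructor
  · exact (integrable_toReal_of_lintegral_ne_top hEm.aemeasurable hfin).congr
      (hsub.mono fun t ht => ht.symm)
  · rw [laplaceTransform, integral_congr_ae hsub, integral_toReal hEm.aemeasurable hfinae, hHL,
      ENNReal.toReal_mul, ENNReal.toReal_ofReal (div_pos (hΦ p hp) hp).le,
      ENNReal.toReal_ofReal (integral_nonneg_of_ae _), hσ.laplaceTransform_tailKernel hp]
    · congr 1
      refine integral_congr_ae ?_
      filter_upwards [hff'] with τ hτ
      rw [hτ]
    · filter_upwards [hf'0] with τ hτ using mul_nonneg (Real.exp_pos _).le hτ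

end InverseLaw

/-! ### Asymptotics of Cesàro means -/

/-- The integrand $1-e^{-p\tau}$ is strictly positive on $(0,\infty)$, so one zero $\Phi(p)=0$
forces `σ` to vanish there, and then $\Phi$ vanishes identically. -/
lemma IsSubordinatorLevyMeasure.laplaceExponent_pos {σ : Measure ℝ}
    (hσ : IsSubordinatorLevyMeasure σ) {q : ℝ} (hq : laplaceExponent σ q ≠ 0) :
    ∀ p > 0, 0 < laplaceExponent σ p := by
  intro p hp
  refine lt_of_le_of_ne (laplaceExponent_nonneg hp.le) fun h => hq ?_
  have h1 := (setIntegral_eq_zero_iff_of_nonneg_ae (by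
    filter_upwards [ae_restrict_mem measurableSet_Ioi] with x hx
    have hx : 0 < x := hx
    have : Real.exp (-p * x) ≤ 1 := Real.exp_le_one_iff.2 (by nlinarith)
    simpa using this) (hσ.integrableOn_one_sub_exp hp.le)).1 h.symm
  have h2 : ∀ᵐ x ∂(σ.restrict (Ioi 0)), False := by
    filter_upwards [h1, ae_restrict_mem measurableSet_Ioi] with x hx hx0
    have hx0 : 0 < x := hx0
    have : Real.exp (-p * x) < 1 := by
      rw [← Real.exp_zero]; exact Real.exp_lt_exp.2 (by nlinarith)
    simp only [Pi.zero_apply] at hx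
    linarith
  rw [laplaceExponent]
  refine integral_eq_zero_of_ae (h2.mono fun _ h => h.elim)

lemma tendsto_div_of_isSlowlyVarying {K : ℝ → ℝ} {ϱ : ℝ}
    (h : IsSlowlyVarying fun x => x ^ (-ϱ) * K x⁻¹) {a : ℝ} (ha : 0 < a) :
    Tendsto (fun p => K (a * p) / K p) (𝓝[>] 0) (𝓝 (a ^ (-ϱ))) := by
  have h1 := ((h a⁻¹ (inv_pos.2 ha)).comp tendsto_inv_nhdsGT_zero).const_mul (a ^ (-ϱ))
  rw [mul_one] at h1
  refine h1.congr' ?_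
  filter_upwards [self_mem_nhdsWithin] with p hp
  have hp : 0 < p := hp
  have h2 : (a⁻¹ * p⁻¹)⁻¹ = a * p := by field_simp
  simp only [Function.comp_apply, inv_inv]
  rw [h2, Real.mul_rpow (inv_pos.2 ha).le (inv_pos.2 hp).le, Real.inv_rpow ha.le]
  have h3 := (Real.rpow_pos_of_pos ha (-ϱ)).ne'
  have h4 := (Real.rpow_pos_of_pos (inv_pos.2 hp) (-ϱ)).ne'
  -- If the denominator vanishes, both quotients are 0 by the division convention.
  rcases eq_or_ne (K p) 0 with h5 | h5
  · simp [h5]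
  · field_simp

/-- The long-time behaviour of the Cesàro mean of a subordinated integrable function. -/
theorem tendsto_cesaroMean_subordination {Ω : Type*} [MeasurableSpace Ω] {P : Measure Ω}
    [IsProbabilityMeasure P] {S : ℝ≥0 → Ω → ℝ} {σ : Measure ℝ} {ϱ : ℝ} (hS : IsSubordinator P S)
    (hσ : IsSubordinatorLevyMeasure σ) (hL : HasLevyMeasure P S σ)
    (hK : Tendsto (fun p => p * laplaceTransform (tailKernel σ) p) (𝓝[>] 0) (𝓝 0))
    (hϱ : 0 ≤ ϱ)
    (hslow : IsSlowlyVarying fun x => x ^ (-ϱ) * laplaceTransform (tailKernel σ) x⁻¹)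
    {f : ℝ → ℝ} (hf0 : ∀ τ > 0, 0 ≤ f τ) (hfi : IntegrableOn f (Ioi 0))
    (hfpos : 0 < ∫ τ in Ioi 0, f τ) :
    Tendsto (fun t => cesaroMean (subordination P S f) t /
      ((∫ τ in Ioi 0, f τ) / Real.Gamma (ϱ + 1) *
        (t⁻¹ * laplaceTransform (tailKernel σ) t⁻¹))) atTop (𝓝 1) := by
  set K := laplaceTransform (tailKernel σ) with hKdef
  set A := ∫ τ in Ioi 0, f τ with hA
  have hKΦ : ∀ p > 0, K p = laplaceExponent σ p / p := fun p hp => hσ.laplaceTransform_tailKernel hp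
  have hΦ : ∀ p > 0, 0 < laplaceExponent σ p := by
    -- If $\Phi$ vanished on $(0,\infty)$, the slowly varying quotient would be $0/0=0$ and could
    -- not tend to 1. Slow variation thus excludes the zero measure.
    obtain ⟨q, hq⟩ : ∃ q, 0 < q ∧ laplaceExponent σ q ≠ 0 := by
      by_contra! hall
      have h1 := hslow 1 one_pos
      have h2 : (fun x : ℝ => (fun x => x ^ (-ϱ) * K x⁻¹) (1 * x) / (fun x => x ^ (-ϱ) * K x⁻¹) x)
          =ᶠ[atTop] fun _ => (0 : ℝ) := by
        filter_upwards [eventually_gt_atTop 0] with x hx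
        have : K x⁻¹ = 0 := by rw [hKΦ _ (inv_pos.2 hx), hall _ (inv_pos.2 hx), zero_div]
        simp [this]
      exact zero_ne_one (tendsto_nhds_unique (tendsto_const_nhds.congr' h2.symm) h1)
    exact hσ.laplaceExponent_pos hq.2
  have hKpos : ∀ p > 0, 0 < K p := fun p hp => by rw [hKΦ p hp]; exact div_pos (hΦ p hp) hp
  set J : ℝ → ℝ := fun p => ∫ τ in Ioi 0, Real.exp (-τ * laplaceExponent σ p) * f τ with hJ
  have hexp : ∀ p > 0, ∀ τ ∈ Ioi (0 : ℝ), Real.exp (-τ * laplaceExponent σ p) ≤ 1 := by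
    intro p hp τ hτ
    have hτ : 0 < τ := hτ
    exact Real.exp_le_one_iff.2 (by nlinarith [hΦ p hp])
  have hJint : ∀ p > 0, IntegrableOn (fun τ => Real.exp (-τ * laplaceExponent σ p) * f τ)
      (Ioi 0) := by
    intro p hp
    refine hfi.bdd_mul (c := 1) (by fun_prop) ?_
    filter_upwards [ae_restrict_mem measurableSet_Ioi] with τ hτ
    rw [Real.norm_of_nonneg (Real.exp_pos _).le]
    exact hexp p hp τ hτ
  have hJpos : ∀ p > 0, 0 < J p := by
    intro p hp
    have hnn : 0 ≤ᵐ[volume.restrict (Ioi 0)] f := by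
      filter_upwards [ae_restrict_mem measurableSet_Ioi] with τ hτ using hf0 τ hτ
    rw [hA, setIntegral_pos_iff_support_of_nonneg_ae hnn hfi] at hfpos
    simp only [hJ]
    rw [setIntegral_pos_iff_support_of_nonneg_ae _ (hJint p hp)]
    · convert hfpos using 3
      ext τ
      simp [(Real.exp_pos _).ne']
    · filter_upwards [hnn] with τ hτ using mul_nonneg (Real.exp_pos _).le hτ
  -- Admissibility enters here: $\Phi(p)=pK(p)\to0$, so $e^{-\tau\Phi(p)}\to1$ with dominating
  -- function $|f|$.
  have hJlim : Tendsto J (𝓝[>] 0) (𝓝 A) := by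
    refine tendsto_integral_filter_of_dominated_convergence (fun τ => ‖f τ‖) ?_ ?_ hfi.norm ?_
    · filter_upwards [self_mem_nhdsWithin] with p hp using (hJint p hp).aestronglyMeasurable
    · filter_upwards [self_mem_nhdsWithin] with p hp
      filter_upwards [ae_restrict_mem measurableSet_Ioi] with τ hτ
      rw [norm_mul, Real.norm_of_nonneg (Real.exp_pos _).le]
      exact mul_le_of_le_one_left (norm_nonneg _) (hexp p hp τ hτ)
    · refine .of_forall fun τ => ?_
      have h1 : Tendsto (laplaceExponent σ) (𝓝[>] 0) (𝓝 0) := by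
        refine hK.congr' ?_
        filter_upwards [self_mem_nhdsWithin] with p hp
        have hp : 0 < p := hp
        rw [hKΦ p hp]
        field_simp
      have h2 := ((h1.const_mul (-τ)).rexp).mul_const (f τ)
      simpa using h2
  set F := laplaceTransform (subordination P S f) with hF
  have hFeq : ∀ p > 0, F p = K p * J p := fun p hp =>
    (laplaceTransform_subordination hS hσ hL hΦ hf0 hfi hp).2
  have hkar := karamata_tauberian (f := subordination P S f) hϱ ?_
    (fun p hp => (laplaceTransform_subordination hS hσ hL hΦ hf0 hfi hp).1)
    (fun p hp => by rw [← hF, hFeq p hp]; exact mul_pos (hKpos p hp) (hJpos p hp)) ?_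
  · have hΓ : 0 < Real.Gamma (ϱ + 1) := Real.Gamma_pos_of_pos (by linarith)
    have h1 := (hkar.mul hJlim).mul_const (Real.Gamma (ϱ + 1) / A)
    have h2 := h1.comp tendsto_inv_atTop_nhdsGT_zero
    have h3 : 1 / Real.Gamma (ϱ + 1) * A * (Real.Gamma (ϱ + 1) / A) = 1 := by
      field_simp
    rw [h3] at h2
    refine h2.congr' ?_
    filter_upwards [eventually_gt_atTop 0] with t ht
    have hp := inv_pos.2 ht
    have e1 := (hKpos _ hp).ne'
    have e2 := (hJpos _ hp).ne'
    simp only [Function.comp_apply, inv_inv]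
    rw [← hF, hFeq _ hp, cesaroMean, intervalIntegral.integral_of_le ht.le]
    generalize K t⁻¹ = k at e1 ⊢
    generalize J t⁻¹ = j at e2 ⊢
    field_simp
  · intro t
    refine setIntegral_nonneg measurableSet_Ioi fun τ hτ => ?_
    exact mul_nonneg (hf0 τ hτ) ENNReal.toReal_nonneg
  · intro n
    have hn : (0 : ℝ) < n + 1 := by positivity
    have hmul : Tendsto (fun p : ℝ => (n + 1) * p) (𝓝[>] 0) (𝓝[>] 0) := by
      refine tendsto_nhdsWithin_iff.2 ⟨?_, ?_⟩
      · have : Tendsto (fun p : ℝ => (n + 1) * p) (𝓝 0) (𝓝 ((n + 1) * 0)) :=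
          tendsto_id.const_mul _
        rw [mul_zero] at this
        exact this.mono_left nhdsWithin_le_nhds
      · filter_upwards [self_mem_nhdsWithin] with p hp using mul_pos hn hp
    -- The transform is $K\cdot J$: the factor $K$ carries the index $-\varrho$, and $J$ has a
    -- nonzero limit, so its ratio tends to 1.
    have h1 := (tendsto_div_of_isSlowlyVarying hslow hn).mul
      ((hJlim.comp hmul).div hJlim hfpos.ne')
    rw [div_self hfpos.ne', mul_one] at h1
    refine h1.congr' ?_
    filter_upwards [self_mem_nhdsWithin] with p hp
    rw [← hF, hFeq p hp, hFeq _ (mul_pos hn hp)]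
    exact div_mul_div_comm _ _ _ _

/-! ### Positivity of the Fourier transform of `exp(-‖ξ‖^{2s})` -/

section Positivity

variable (V : Type*) [NormedAddCommGroup V] [InnerProductSpace ℝ V] [FiniteDimensional ℝ V]
  [MeasurableSpace V] [BorelSpace V]

/-- Bounded functions `f` on the half-line such that all the functions
`exp(-δ‖ξ‖²) f(‖ξ‖²)` have a nonnegative Fourier transform. -/
structure IsGaussianPositive (f : ℝ → ℝ) : Prop where
  measurable : Measurable f
  bounded : ∃ C, ∀ l ≥ 0, |f l| ≤ C
  nonneg : ∀ δ > 0, ∀ x : V,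
    0 ≤ ∫ ξ : V, Real.cos (inner ℝ x ξ) * Real.exp (-δ * ‖ξ‖ ^ 2) * f (‖ξ‖ ^ 2)

variable {V}

lemma integrable_exp_neg_mul_norm_sq {δ : ℝ} (hδ : 0 < δ) :
    Integrable fun ξ : V => Real.exp (-δ * ‖ξ‖ ^ 2) := by
  have h := (GaussianFourier.integrable_cexp_neg_mul_sq_norm_add (V := V) (b := δ)
    (by simpa using hδ) 0 0).norm
  refine h.congr (.of_forall fun ξ => ?_)
  simp only [Complex.norm_exp]
  norm_cast
  simp

namespace IsGaussianPositive

lemma integrable {f : ℝ → ℝ} (hf : Measurable f) (hb : ∃ C, ∀ l ≥ 0, |f l| ≤ C) {δ : ℝ}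
    (hδ : 0 < δ) (x : V) :
    Integrable fun ξ : V => Real.cos (inner ℝ x ξ) * Real.exp (-δ * ‖ξ‖ ^ 2) * f (‖ξ‖ ^ 2) := by
  obtain ⟨C, hC⟩ := hb
  refine ((integrable_exp_neg_mul_norm_sq hδ).mul_const C).mono'
    (Measurable.aestronglyMeasurable (by fun_prop)) (.of_forall fun ξ => ?_)
  rw [norm_mul, norm_mul, Real.norm_of_nonneg (Real.exp_pos _).le]
  refine mul_le_mul ?_ (hC _ (by positivity)) (norm_nonneg _) (Real.exp_pos _).le
  exact mul_le_of_le_one_left (Real.exp_pos _).le (Real.abs_cos_le_one _)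

/-- The Fourier transform of a Gaussian is a positive Gaussian. -/
lemma one : IsGaussianPositive V fun _ => 1 where
  measurable := measurable_const
  bounded := ⟨1, fun _ _ => by simp⟩
  nonneg δ hδ x := by
    have h := GaussianFourier.integral_cexp_neg_mul_sq_norm_add (V := V) (b := δ)
      (by simpa using hδ) Complex.I x
    have hint := GaussianFourier.integrable_cexp_neg_mul_sq_norm_add (V := V) (b := δ)
      (by simpa using hδ) Complex.I x
    have h2 : ∀ ξ : V, Real.cos (inner ℝ x ξ) * Real.exp (-δ * ‖ξ‖ ^ 2) * 1 =
        (Complex.exp (-δ * ‖ξ‖ ^ 2 + Complex.I * (inner ℝ x ξ : ℝ))).re := by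
      intro ξ
      rw [Complex.exp_re]
      have e1 : (-(δ : ℂ) * ‖ξ‖ ^ 2 + Complex.I * (inner ℝ x ξ : ℝ)).re = -δ * ‖ξ‖ ^ 2 := by
        simp [← Complex.ofReal_pow]
      have e2 : (-(δ : ℂ) * ‖ξ‖ ^ 2 + Complex.I * (inner ℝ x ξ : ℝ)).im = inner ℝ x ξ := by
        simp [← Complex.ofReal_pow]
      rw [e1, e2]; ring
    simp_rw [h2]
    have h3 := integral_re hint
    simp only [RCLike.re_eq_complex_re] at h3
    rw [h3, h]
    have h4 : ((Real.pi / δ : ℂ)) ^ (Module.finrank ℝ V / 2 : ℂ) *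
        Complex.exp (Complex.I ^ 2 * ‖x‖ ^ 2 / (4 * δ)) =
        (((Real.pi / δ) ^ (Module.finrank ℝ V / 2 : ℝ) *
          Real.exp (-1 * ‖x‖ ^ 2 / (4 * δ)) : ℝ) : ℂ) := by
      push_cast
      rw [Complex.ofReal_cpow (by positivity), Complex.I_sq]
      push_cast
      rfl
    rw [h4, Complex.ofReal_re]
    positivity

lemma const_mul {f : ℝ → ℝ} (hf : IsGaussianPositive V f) {c : ℝ} (hc : 0 ≤ c) :
    IsGaussianPositive V fun l => c * f l where
  measurable := hf.measurable.const_mul c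
  bounded := by
    obtain ⟨C, hC⟩ := hf.bounded
    refine ⟨c * C, fun l hl => ?_⟩
    rw [abs_mul, abs_of_nonneg hc]
    exact mul_le_mul_of_nonneg_left (hC l hl) hc
  nonneg δ hδ x := by
    simp_rw [mul_left_comm _ c]
    rw [integral_const_mul]
    exact mul_nonneg hc (hf.nonneg δ hδ x)

lemma sum {f : ℕ → ℝ → ℝ} (hf : ∀ n, IsGaussianPositive V (f n)) (m : ℕ) :
    IsGaussianPositive V fun l => ∑ n ∈ Finset.range m, f n l where
  measurable := Finset.measurable_fun_sum _ fun n _ => (hf n).measurable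
  bounded := by
    choose C hC using fun n => (hf n).bounded
    exact ⟨∑ n ∈ Finset.range m, C n, fun l hl => (Finset.abs_sum_le_sum_abs _ _).trans
      (Finset.sum_le_sum fun n _ => hC n l hl)⟩
  nonneg δ hδ x := by
    simp_rw [Finset.mul_sum]
    rw [integral_finsetSum _ fun n _ => integrable (hf n).measurable (hf n).bounded hδ x]
    exact Finset.sum_nonneg fun n _ => (hf n).nonneg δ hδ x

lemma of_tendsto {f : ℕ → ℝ → ℝ} {g : ℝ → ℝ} (hf : ∀ n, IsGaussianPositive V (f n)) {C : ℝ}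
    (hC : ∀ n, ∀ l ≥ 0, |f n l| ≤ C) (hg : Measurable g)
    (hlim : ∀ l ≥ 0, Tendsto (fun n => f n l) atTop (𝓝 (g l))) : IsGaussianPositive V g where
  measurable := hg
  bounded := ⟨C, fun l hl => le_of_tendsto' (hlim l hl).abs fun n => hC n l hl⟩
  nonneg δ hδ x := by
    refine ge_of_tendsto' (tendsto_integral_of_dominated_convergence
      (fun ξ : V => Real.exp (-δ * ‖ξ‖ ^ 2) * C) (fun n =>
        (integrable (hf n).measurable ⟨C, hC n⟩ hδ x).aestronglyMeasurable)
      ((integrable_exp_neg_mul_norm_sq hδ).mul_const C) (fun n => .of_forall fun ξ => ?_)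
      (.of_forall fun ξ => (hlim _ (by positivity)).const_mul _))
      fun n => (hf n).nonneg δ hδ x
    rw [norm_mul, norm_mul, Real.norm_of_nonneg (Real.exp_pos _).le]
    refine mul_le_mul ?_ (hC _ _ (by positivity)) (norm_nonneg _) (Real.exp_pos _).le
    exact mul_le_of_le_one_left (Real.exp_pos _).le (Real.abs_cos_le_one _)

variable {w : ℝ → ℝ} {a : ℝ}

/-- A factor $e^{-u\|\xi\|^2}$ only shifts the Gaussian parameter from $\delta$ to $\delta+u$, and
positivity survives integration against $w\ge0$. Requiring it for every $\delta>0$ in the definition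
is what makes this step possible. -/
lemma mul_laplace {f : ℝ → ℝ} (hf : IsGaussianPositive V f) (ha : 0 ≤ a) (hw : Measurable w)
    (hw0 : ∀ u ∈ Ioi a, 0 ≤ w u) (hwi : IntegrableOn w (Ioi a)) :
    IsGaussianPositive V fun l => f l * ∫ u in Ioi a, w u * Real.exp (-u * l) where
  measurable := by
    refine hf.measurable.mul (StronglyMeasurable.measurable ?_)
    exact (by fun_prop : Measurable fun z : ℝ × ℝ =>
      w z.2 * Real.exp (-z.2 * z.1)).stronglyMeasurable.integral_prod_right'
  bounded := by
    obtain ⟨C, hC⟩ := hf.bounded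
    refine ⟨C * ∫ u in Ioi a, w u, fun l hl => ?_⟩
    rw [abs_mul]
    refine mul_le_mul (hC l hl) ?_ (abs_nonneg _) ((abs_nonneg _).trans (hC l hl))
    refine norm_integral_le_of_norm_le (f := fun u => w u * Real.exp (-u * l)) hwi ?_
    filter_upwards [ae_restrict_mem measurableSet_Ioi] with u hu
    have hu0 : 0 < u := ha.trans_lt hu
    rw [norm_mul, Real.norm_of_nonneg (hw0 u hu), Real.norm_of_nonneg (Real.exp_pos _).le]
    exact mul_le_of_le_one_right (hw0 u hu) (Real.exp_le_one_iff.2 (by nlinarith))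
  nonneg δ hδ x := by
    obtain ⟨C, hC⟩ := hf.bounded
    have hfm := hf.measurable
    set F : V × ℝ → ℝ := fun z => Real.cos (inner ℝ x z.1) * Real.exp (-δ * ‖z.1‖ ^ 2) *
      (f (‖z.1‖ ^ 2) * (w z.2 * Real.exp (-z.2 * ‖z.1‖ ^ 2))) with hF
    have hFm : Measurable F := by fun_prop
    have hFi : Integrable F (volume.prod (volume.restrict (Ioi a))) := by
      have h1 : Integrable (fun z : V × ℝ => (Real.exp (-δ * ‖z.1‖ ^ 2) * C) * w z.2)
          (volume.prod (volume.restrict (Ioi a))) :=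
        ((integrable_exp_neg_mul_norm_sq hδ).mul_const C).mul_prod hwi
      refine h1.mono' hFm.aestronglyMeasurable ?_
      have h2 : ∀ᵐ z ∂((volume : Measure V).prod (volume.restrict (Ioi a))), z.2 ∈ Ioi a :=
        Measure.quasiMeasurePreserving_snd.ae (ae_restrict_mem measurableSet_Ioi)
      filter_upwards [h2] with z hz
      have hz0 : 0 < z.2 := ha.trans_lt hz
      simp only [hF]
      rw [norm_mul, norm_mul, norm_mul, norm_mul, Real.norm_of_nonneg (Real.exp_pos _).le,
        Real.norm_of_nonneg (Real.exp_pos (-z.2 * _)).le, Real.norm_of_nonneg (hw0 _ hz),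
        Real.norm_eq_abs, Real.norm_eq_abs, mul_assoc (Real.exp _)]
      refine mul_le_mul (mul_le_of_le_one_left (Real.exp_pos _).le (Real.abs_cos_le_one _))
        (mul_le_mul (hC _ (by positivity)) (mul_le_of_le_one_right (hw0 _ hz)
          (Real.exp_le_one_iff.2 ?_)) (mul_nonneg (hw0 _ hz) (Real.exp_pos _).le)
          ((abs_nonneg _).trans (hC _ (sq_nonneg ‖z.1‖)))) (mul_nonneg (abs_nonneg _)
          (mul_nonneg (hw0 _ hz) (Real.exp_pos _).le)) (Real.exp_pos _).le
      nlinarith [sq_nonneg ‖z.1‖]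
    have h1 : ∀ ξ : V, Real.cos (inner ℝ x ξ) * Real.exp (-δ * ‖ξ‖ ^ 2) *
        (f (‖ξ‖ ^ 2) * ∫ u in Ioi a, w u * Real.exp (-u * ‖ξ‖ ^ 2)) =
        ∫ u in Ioi a, F (ξ, u) := by
      intro ξ
      simp only [hF]
      rw [integral_const_mul, integral_const_mul]
    simp_rw [h1]
    rw [integral_integral_swap hFi]
    refine setIntegral_nonneg measurableSet_Ioi fun u hu => ?_
    have h2 : ∀ ξ : V, F (ξ, u) = w u * (Real.cos (inner ℝ x ξ) *
        Real.exp (-(δ + u) * ‖ξ‖ ^ 2) * f (‖ξ‖ ^ 2)) := by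
      intro ξ
      simp only [hF]
      have : -(δ + u) * ‖ξ‖ ^ 2 = -δ * ‖ξ‖ ^ 2 + -u * ‖ξ‖ ^ 2 := by ring
      rw [this, Real.exp_add]; ring
    simp_rw [h2]
    rw [integral_const_mul]
    exact mul_nonneg (hw0 u hu) (hf.nonneg _ (by linarith [ha.trans_lt (mem_Ioi.1 hu)]) x)

/-- The compound Poisson case: with $c=\int w$ finite and $\psi(l)=\int w(u)e^{-ul}\,du$, the
function is $e^{-c}\sum_n\psi^n/n!$, and each power is covered by `mul_laplace`. -/
lemma exp_neg_integral (ha : 0 ≤ a) (hw : Measurable w)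
    (hw0 : ∀ u ∈ Ioi a, 0 ≤ w u) (hwi : IntegrableOn w (Ioi a)) :
    IsGaussianPositive V fun l =>
      Real.exp (-∫ u in Ioi a, w u * (1 - Real.exp (-u * l))) := by
  set ψ : ℝ → ℝ := fun l => ∫ u in Ioi a, w u * Real.exp (-u * l) with hψ
  set c := ∫ u in Ioi a, w u with hc
  have hexp : ∀ l ≥ 0, ∀ u ∈ Ioi a, Real.exp (-u * l) ≤ 1 := by
    intro l hl u hu
    have hu0 : 0 < u := ha.trans_lt hu
    exact Real.exp_le_one_iff.2 (by nlinarith)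
  have hpow : ∀ n : ℕ, IsGaussianPositive V fun l => ψ l ^ n := by
    intro n
    induction n with
    | zero => simpa using one
    | succ n ih =>
      simp_rw [pow_succ]
      exact ih.mul_laplace ha hw hw0 hwi
  have hψi : ∀ l ≥ 0, IntegrableOn (fun u => w u * Real.exp (-u * l)) (Ioi a) := by
    intro l hl
    refine Integrable.mul_bdd (c := 1) hwi (by fun_prop) ?_
    filter_upwards [ae_restrict_mem measurableSet_Ioi] with u hu
    rw [Real.norm_of_nonneg (Real.exp_pos _).le]
    exact hexp l hl u hu
  have hψ0 : ∀ l, 0 ≤ ψ l := fun l => setIntegral_nonneg measurableSet_Ioi fun u hu =>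
    mul_nonneg (hw0 u hu) (Real.exp_pos _).le
  have hψc : ∀ l ≥ 0, ψ l ≤ c := fun l hl =>
    setIntegral_mono_on (hψi l hl) hwi measurableSet_Ioi fun u hu =>
      mul_le_of_le_one_right (hw0 u hu) (hexp l hl u hu)
  have hser : IsGaussianPositive V fun l => Real.exp (ψ l) := by
    have hsum : ∀ n, ∀ l ≥ 0, ∑ k ∈ Finset.range n, (k.factorial : ℝ)⁻¹ * ψ l ^ k ≤
        Real.exp c := by
      intro n l hl
      refine le_trans ?_ (Real.exp_le_exp.2 (hψc l hl))
      refine le_trans (Finset.sum_le_sum fun k _ => ?_) (Real.sum_le_exp_of_nonneg (hψ0 l) n)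
      rw [div_eq_inv_mul]
    refine of_tendsto (f := fun n l => ∑ k ∈ Finset.range n, (k.factorial : ℝ)⁻¹ * ψ l ^ k)
      (C := Real.exp c) (fun n => sum (fun k => (hpow k).const_mul (by positivity)) n)
      (fun n l hl => ?_) (by simpa using! (hpow 1).measurable.exp) fun l _ => ?_
    · rw [abs_of_nonneg (Finset.sum_nonneg fun k _ => by have := hψ0 l; positivity)]
      exact hsum n l hl
    · have := (NormedSpace.expSeries_div_hasSum_exp (ψ l)).tendsto_sum_nat
      rw [← Real.exp_eq_exp_ℝ] at this
      refine this.congr fun n => Finset.sum_congr rfl fun k _ => ?_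
      rw [div_eq_inv_mul]
  have hfinal := hser.const_mul (Real.exp_pos (-c)).le
  have heq : ∀ l ≥ 0, Real.exp (-∫ u in Ioi a, w u * (1 - Real.exp (-u * l))) =
      Real.exp (-c) * Real.exp (ψ l) := by
    intro l hl
    rw [← Real.exp_add]
    congr 1
    simp_rw [mul_sub, mul_one]
    rw [integral_sub hwi (hψi l hl)]
    ring
  -- The closed form holds only for $l\ge0$. The limit lemma, applied to a constant sequence,
  -- transfers positivity across equality on that half-line.
  refine of_tendsto (fun _ : ℕ => hfinal) (C := 1) (fun _ l hl => ?_) ?_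
    (fun l hl => by rw [heq l hl]; exact tendsto_const_nhds)
  · rw [← Real.exp_add, abs_of_pos (Real.exp_pos _), Real.exp_le_one_iff]
    linarith [hψc l hl]
  · refine (StronglyMeasurable.measurable ?_).neg.exp
    exact (by fun_prop : Measurable fun z : ℝ × ℝ =>
      w z.2 * (1 - Real.exp (-z.2 * z.1))).stronglyMeasurable.integral_prod_right'

end IsGaussianPositive

/-- Near 0 the bound $1-e^{-u}\le u$ leaves $u^{-s}$, integrable since $s<1$; beyond 1 the bound
$u^{-1-s}$ is integrable since $s>0$. -/
lemma integrableOn_one_sub_exp_mul_rpow {s : ℝ} (hs0 : 0 < s) (hs1 : s < 1) :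
    IntegrableOn (fun u => u ^ (-1 - s) * (1 - Real.exp (-u))) (Ioi 0) := by
  have hm : Measurable fun u : ℝ => u ^ (-1 - s) * (1 - Real.exp (-u)) := by fun_prop
  rw [← Ioc_union_Ioi_eq_Ioi (zero_le_one' ℝ)]
  refine IntegrableOn.union ?_ ?_
  · have h1 : IntegrableOn (fun u : ℝ => u ^ (-s)) (Ioc 0 1) := by
      rw [← intervalIntegrable_iff_integrableOn_Ioc_of_le zero_le_one]
      exact intervalIntegral.intervalIntegrable_rpow' (by linarith)
    refine h1.mono' hm.aestronglyMeasurable ?_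
    filter_upwards [ae_restrict_mem measurableSet_Ioc] with u hu
    have h2 : Real.exp (-u) ≤ 1 := Real.exp_le_one_iff.2 (by linarith [hu.1])
    have h3 := Real.add_one_le_exp (-u)
    have h4 := Real.rpow_pos_of_pos hu.1 (-1 - s)
    rw [norm_mul, Real.norm_of_nonneg h4.le, Real.norm_of_nonneg (by linarith)]
    calc u ^ (-1 - s) * (1 - Real.exp (-u)) ≤ u ^ (-1 - s) * u :=
          mul_le_mul_of_nonneg_left (by linarith) h4.le
      _ = u ^ (-s) := by
          rw [← Real.rpow_add_one hu.1.ne']; congr 1; ring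
  · refine (integrableOn_Ioi_rpow_of_lt (by linarith : -1 - s < -1) one_pos).mono'
      hm.aestronglyMeasurable ?_
    filter_upwards [ae_restrict_mem measurableSet_Ioi] with u hu
    have hu0 : (0 : ℝ) < u := one_pos.trans hu
    have h2 : Real.exp (-u) ≤ 1 := Real.exp_le_one_iff.2 (by linarith)
    have h4 := Real.rpow_pos_of_pos hu0 (-1 - s)
    rw [norm_mul, Real.norm_of_nonneg h4.le, Real.norm_of_nonneg (by linarith)]
    exact mul_le_of_le_one_right h4.le (by linarith [Real.exp_pos (-u)])

lemma integral_one_sub_exp_mul_rpow_pos {s : ℝ} (hs0 : 0 < s) (hs1 : s < 1) :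
    0 < ∫ u in Ioi 0, u ^ (-1 - s) * (1 - Real.exp (-u)) := by
  have hpos : ∀ u ∈ Ioi (0 : ℝ), 0 < u ^ (-1 - s) * (1 - Real.exp (-u)) := by
    intro u hu
    have hu : 0 < u := hu
    refine mul_pos (Real.rpow_pos_of_pos hu _) (sub_pos.2 ?_)
    rw [← Real.exp_zero]
    exact Real.exp_lt_exp.2 (by linarith)
  rw [setIntegral_pos_iff_support_of_nonneg_ae _ (integrableOn_one_sub_exp_mul_rpow hs0 hs1)]
  · have : Ioi (0 : ℝ) ⊆ (Function.support fun u : ℝ => u ^ (-1 - s) * (1 - Real.exp (-u))) ∩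
        Ioi 0 := fun u hu => ⟨(hpos u hu).ne', hu⟩
    refine lt_of_lt_of_le ?_ (measure_mono this)
    simp
  · filter_upwards [ae_restrict_mem measurableSet_Ioi] with u hu using (hpos u hu).le

lemma integral_one_sub_exp_mul_rpow_scale {s : ℝ} (hs0 : 0 < s) {l : ℝ} (hl : 0 ≤ l) :
    ∫ u in Ioi 0, u ^ (-1 - s) * (1 - Real.exp (-u * l)) =
      l ^ s * ∫ u in Ioi 0, u ^ (-1 - s) * (1 - Real.exp (-u)) := by
  rcases hl.eq_or_lt with rfl | hl
  · simp [Real.zero_rpow hs0.ne']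
  have h1 := integral_comp_mul_left_Ioi (fun u => u ^ (-1 - s) * (1 - Real.exp (-u))) 0 hl
  rw [mul_zero, smul_eq_mul] at h1
  have h2 : l ^ s * ∫ u in Ioi 0, u ^ (-1 - s) * (1 - Real.exp (-u)) = l ^ (s + 1) *
      (l⁻¹ * ∫ u in Ioi 0, u ^ (-1 - s) * (1 - Real.exp (-u))) := by
    rw [Real.rpow_add_one hl.ne']
    field_simp
  rw [h2, ← h1, ← integral_const_mul]
  refine setIntegral_congr_fun measurableSet_Ioi fun u hu => ?_
  have hu : 0 < u := hu
  rw [Real.mul_rpow hl.le hu.le, ← mul_assoc, ← mul_assoc, ← Real.rpow_add hl]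
  have : s + 1 + (-1 - s) = 0 := by ring
  rw [this, Real.rpow_zero, one_mul]
  congr 3
  ring_nf

/-- Uses $l^s=c^{-1}\int_0^\infty u^{-1-s}(1-e^{-ul})\,du$. The weight has infinite mass at 0, so it
is cut off at $u>1/(n+1)$, where the compound Poisson case applies, and $n\to\infty$. -/
lemma isGaussianPositive_exp_neg_rpow {s : ℝ} (hs0 : 0 < s) (hs1 : s < 1) :
    IsGaussianPositive V fun l => Real.exp (-l ^ s) := by
  set c := ∫ u in Ioi 0, u ^ (-1 - s) * (1 - Real.exp (-u)) with hc
  have hcpos : 0 < c := integral_one_sub_exp_mul_rpow_pos hs0 hs1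
  set w : ℝ → ℝ := fun u => c⁻¹ * u ^ (-1 - s) with hw
  set a : ℕ → ℝ := fun n => 1 / ((n : ℝ) + 1) with ha
  have ha0 : ∀ n, 0 < a n := fun n => by positivity
  have hw0 : ∀ u > 0, 0 ≤ w u := fun u hu =>
    mul_nonneg (inv_pos.2 hcpos).le (Real.rpow_nonneg (le_of_lt hu) _)
  have hnn : ∀ l ≥ 0, ∀ u ∈ Ioi (0 : ℝ), 0 ≤ w u * (1 - Real.exp (-u * l)) := by
    intro l hl u hu
    have hu : 0 < u := hu
    have : Real.exp (-u * l) ≤ 1 := Real.exp_le_one_iff.2 (by nlinarith)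
    exact mul_nonneg (hw0 u hu) (by linarith)
  have hval : ∀ l ≥ 0, ∫ u in Ioi 0, w u * (1 - Real.exp (-u * l)) = l ^ s := by
    intro l hl
    simp only [hw, mul_assoc]
    rw [integral_const_mul, integral_one_sub_exp_mul_rpow_scale hs0 hl, ← hc]
    field_simp
  have hint : ∀ l ≥ 0, IntegrableOn (fun u => w u * (1 - Real.exp (-u * l))) (Ioi 0) := by
    intro l hl
    rcases hl.eq_or_lt with rfl | hl'
    · simp
    -- The integral is known to equal $l^s>0$, whereas a non-integrable function would have integral
    -- 0 by convention.
    · by_contra h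
      have h1 := integral_undef h
      rw [hval l hl] at h1
      exact (Real.rpow_pos_of_pos hl' s).ne' h1
  refine IsGaussianPositive.of_tendsto (C := 1)
    (f := fun n l => Real.exp (-∫ u in Ioi (a n), w u * (1 - Real.exp (-u * l))))
    (fun n => IsGaussianPositive.exp_neg_integral (ha0 n).le (by fun_prop)
      (fun u hu => hw0 u ((ha0 n).trans hu))
      ((integrableOn_Ioi_rpow_of_lt (by linarith) (ha0 n)).const_mul _)) (fun n l hl => ?_)
    (by fun_prop) fun l hl => ?_
  · rw [abs_of_pos (Real.exp_pos _), Real.exp_le_one_iff, neg_nonpos]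
    exact setIntegral_nonneg measurableSet_Ioi fun u hu => hnn l hl u ((ha0 n).trans hu)
  · refine Tendsto.rexp (Tendsto.neg ?_)
    have hU : ⋃ n, Ioi (a n) = Ioi 0 := by
      ext u
      simp only [mem_iUnion, mem_Ioi]
      exact ⟨fun ⟨n, hn⟩ => (ha0 n).trans hn, fun hu => exists_nat_one_div_lt hu⟩
    have h1 := tendsto_setIntegral_of_monotone (μ := volume)
      (f := fun u => w u * (1 - Real.exp (-u * l))) (s := fun n => Ioi (a n))
      (fun n => measurableSet_Ioi)
      (fun m n hmn => Ioi_subset_Ioi (one_div_le_one_div_of_le (by positivity)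
        (by simpa using hmn))) (by rw [hU]; exact hint l hl)
    rw [hU, hval l hl] at h1
    exact h1

lemma integrable_exp_neg_mul_norm_rpow [Nontrivial V] {b p : ℝ} (hb : 0 < b) (hp : 0 < p) :
    Integrable fun ξ : V => Real.exp (-b * ‖ξ‖ ^ p) := by
  rw [integrable_fun_norm_addHaar volume (f := fun y => Real.exp (-b * y ^ p))]
  have hdim : 0 < Module.finrank ℝ V := Module.finrank_pos
  refine (integrableOn_rpow_mul_exp_neg_mul_rpow (p := p)
    (s := ((Module.finrank ℝ V - 1 : ℕ) : ℝ)) (b := b) ?_ hp hb).congr_fun (fun y _ => ?_)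
    measurableSet_Ioi
  · exact lt_of_lt_of_le (by norm_num) (Nat.cast_nonneg _)
  · simp [Real.rpow_natCast]

/-- The Fourier transform of `exp(-‖ξ‖^{2s})` is nonnegative for `0 < s < 1`. -/
theorem integral_cos_mul_exp_neg_norm_rpow_nonneg [Nontrivial V] {s : ℝ} (hs0 : 0 < s)
    (hs1 : s < 1) (x : V) :
    0 ≤ ∫ ξ : V, Real.cos (inner ℝ x ξ) * Real.exp (-‖ξ‖ ^ (2 * s)) := by
  have hpow : ∀ ξ : V, (‖ξ‖ ^ 2) ^ s = ‖ξ‖ ^ (2 * s) := fun ξ => by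
    rw [Real.rpow_mul (norm_nonneg _)]; norm_num
  have hb : Integrable fun ξ : V => Real.exp (-‖ξ‖ ^ (2 * s)) := by
    simpa using integrable_exp_neg_mul_norm_rpow (V := V) one_pos (by linarith : 0 < 2 * s)
  have hG := isGaussianPositive_exp_neg_rpow (V := V) hs0 hs1
  -- The Gaussian regulariser, with $\delta=1/(n+1)$, is removed by dominated convergence.
  have hlim : Tendsto (fun n : ℕ => ∫ ξ : V, Real.cos (inner ℝ x ξ) *
      Real.exp (-(1 / ((n : ℝ) + 1)) * ‖ξ‖ ^ 2) * Real.exp (-(‖ξ‖ ^ 2) ^ s)) atTop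
      (𝓝 (∫ ξ : V, Real.cos (inner ℝ x ξ) * Real.exp (-‖ξ‖ ^ (2 * s)))) := by
    refine tendsto_integral_of_dominated_convergence
      (fun ξ : V => Real.exp (-‖ξ‖ ^ (2 * s))) (fun n =>
        (IsGaussianPositive.integrable hG.measurable hG.bounded
          (by positivity) x).aestronglyMeasurable) hb (fun n => .of_forall fun ξ => ?_)
      (.of_forall fun ξ => ?_)
    · rw [hpow, norm_mul, norm_mul, Real.norm_of_nonneg (Real.exp_pos _).le,
        Real.norm_of_nonneg (Real.exp_pos _).le]
      refine mul_le_of_le_one_left (Real.exp_pos _).le (mul_le_one₀ (Real.abs_cos_le_one _)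
        (Real.exp_pos _).le (Real.exp_le_one_iff.2 ?_))
      have : 0 ≤ 1 / ((n : ℝ) + 1) * ‖ξ‖ ^ 2 := by positivity
      linarith
    · rw [hpow]
      have h1 : Tendsto (fun n : ℕ => Real.exp (-(1 / ((n : ℝ) + 1)) * ‖ξ‖ ^ 2)) atTop (𝓝 1) := by
        have := ((tendsto_one_div_add_atTop_nhds_zero_nat (𝕜 := ℝ)).neg.mul_const (‖ξ‖ ^ 2)).rexp
        simpa using this
      have h2 := (h1.const_mul (Real.cos (inner ℝ x ξ))).mul_const (Real.exp (-‖ξ‖ ^ (2 * s)))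
      simpa using h2
  exact ge_of_tendsto' hlim fun n => hG.nonneg _ (by positivity) x

end Positivity

/-! ### Integrability of a nonnegative Fourier transform -/

section Fourier

variable {V : Type*} [NormedAddCommGroup V] [InnerProductSpace ℝ V] [FiniteDimensional ℝ V]
  [MeasurableSpace V] [BorelSpace V]

lemma continuous_fourier_of_integrable {f : V → ℂ} (hf : Integrable f) : Continuous (𝓕 f) :=
  VectorFourier.fourierIntegral_continuous Real.continuous_fourierChar
    (by exact continuous_inner) hf

/-- A continuous integrable function with nonnegative Fourier transform has an integrable Fourier
transform. -/
theorem integrable_fourier_of_nonneg {f : V → ℂ} (hfc : Continuous f) (hf : Integrable f)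
    {k : V → ℝ} (hk : ∀ x, 𝓕 f x = k x) (hk0 : ∀ x, 0 ≤ k x) : Integrable k := by
  have hkc : Continuous k := by
    have h1 := Complex.continuous_re.comp (continuous_fourier_of_integrable hf)
    refine h1.congr fun x => ?_
    simp [hk]
  set g : ℕ → V → ℝ := fun n w => Real.exp (-((n : ℝ) + 1)⁻¹ * ‖w‖ ^ 2) with hg
  have hgint : ∀ n, Integrable (g n) := fun n => integrable_exp_neg_mul_norm_sq (by positivity)
  have hkb : ∀ w, ‖k w‖ ≤ ∫ v, ‖f v‖ := by
    intro w
    have := VectorFourier.norm_fourierIntegral_le_integral_norm Real.fourierChar volume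
      (innerₗ V) f w
    have h2 : ‖(k w : ℂ)‖ ≤ ∫ v, ‖f v‖ := by rw [← hk]; exact this
    simpa using h2
  have hgk : ∀ n, Integrable fun w => g n w * k w := fun n =>
    (hgint n).mul_bdd (c := ∫ v, ‖f v‖) hkc.aestronglyMeasurable (.of_forall hkb)
  -- Moving the Fourier transform onto the Gaussian weight gives an approximate identity acting on
  -- `f` at 0, so the regularised integrals of `k` converge.
  have hlim : Tendsto (fun n : ℕ => ∫ w, g n w * k w) atTop (𝓝 (f 0).re) := by
    have h1 := (Complex.continuous_re.tendsto _).comp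
      ((Real.tendsto_integral_gaussian_smul' hf hfc.continuousAt (v := 0)).comp
        (tendsto_natCast_atTop_atTop.comp (tendsto_add_atTop_nat 1)))
    refine h1.congr fun n => ?_
    have hc : 0 < ((n + 1 : ℕ) : ℝ) := by positivity
    have h2 := VectorFourier.integral_fourierIntegral_smul_eq_flip (L := innerₗ V)
      Real.continuous_fourierChar continuous_inner
      (f := fun w : V => Complex.exp (-((((n + 1 : ℕ) : ℝ)⁻¹ : ℝ) : ℂ) * ‖w‖ ^ 2)) (by
        simpa using GaussianFourier.integrable_cexp_neg_mul_sq_norm_add (V := V)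
          (b := ((((n + 1 : ℕ) : ℝ)⁻¹ : ℝ) : ℂ)) (by rw [Complex.ofReal_re]; exact inv_pos.2 hc) 0 0) hf
    have h3 : ∀ w : V, VectorFourier.fourierIntegral Real.fourierChar volume (innerₗ V)
        (fun w : V => Complex.exp (-((((n + 1 : ℕ) : ℝ)⁻¹ : ℝ) : ℂ) * ‖w‖ ^ 2)) w =
        (Real.pi * ((n + 1 : ℕ) : ℝ) : ℂ) ^ (Module.finrank ℝ V / 2 : ℂ) *
          Complex.exp (-Real.pi ^ 2 * ((n + 1 : ℕ) : ℝ) * ‖0 - w‖ ^ 2) := by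
      intro w
      have := fourier_gaussian_innerProductSpace (V := V) (b := ((((n + 1 : ℕ) : ℝ)⁻¹ : ℝ) : ℂ))
        (by rw [Complex.ofReal_re]; exact inv_pos.2 hc) w
      refine this.trans ?_
      rw [zero_sub, norm_neg]
      push_cast
      simp only [div_inv_eq_mul]
      congr 2
      ring
    simp_rw [h3] at h2
    simp only [Function.comp_apply]
    rw [h2, ← Complex.ofReal_re (∫ w, g n w * k w), ← integral_complex_ofReal]
    congr 2
    ext w
    have h4 : VectorFourier.fourierIntegral Real.fourierChar volume (innerₗ V).flip f w = k w := by
      rw [← hk, flip_innerₗ]; rfl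
    rw [h4]
    simp only [hg, smul_eq_mul]
    push_cast
    rfl
  refine ⟨hkc.aestronglyMeasurable, ?_⟩
  -- Since $k\ge0$, these integrals are $L^1$ norms, and Fatou bounds the norm of `k` by their
  -- finite limit.
  have hfatou : ∫⁻ x, ‖k x‖ₑ ≤ liminf (fun n => ∫⁻ x, ‖g n x * k x‖ₑ) atTop := by
    refine le_trans (lintegral_mono fun x => ?_)
      (lintegral_liminf_le' fun n => (hgk n).aestronglyMeasurable.enorm)
    have h1 : Tendsto (fun n : ℕ => g n x * k x) atTop (𝓝 (k x)) := by
      have := ((tendsto_one_div_add_atTop_nhds_zero_nat (𝕜 := ℝ)).neg.mul_const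
        (‖x‖ ^ 2)).rexp.mul_const (k x)
      simpa [hg] using this
    exact (h1.enorm.liminf_eq).ge
  have h2 : ∀ n, ∫⁻ x, ‖g n x * k x‖ₑ = ENNReal.ofReal (∫ x, g n x * k x) := by
    intro n
    rw [ofReal_integral_eq_lintegral_ofReal (hgk n)
      (.of_forall fun x => mul_nonneg (Real.exp_pos _).le (hk0 x))]
    refine lintegral_congr fun x => ?_
    rw [← ofReal_norm, Real.norm_of_nonneg (mul_nonneg (Real.exp_pos _).le (hk0 x))]
  simp_rw [h2] at hfatou
  rw [(ENNReal.tendsto_ofReal hlim).liminf_eq] at hfatou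
  exact hfatou.trans_lt ENNReal.ofReal_lt_top

end Fourier

/-! ### The fractional heat kernel -/

section Kernel

variable {N : ℕ} {s : ℝ}

/-- The Fourier transform `exp(-t|2πξ|^{2s})` of the fractional heat kernel. -/
noncomputable def heatMultiplier (s t : ℝ) (ξ : EuclideanSpace ℝ (Fin N)) : ℝ :=
  Real.exp (-t * fracLaplacianSymbol s ξ)

lemma fracLaplacianSymbol_nonneg (s : ℝ) (ξ : EuclideanSpace ℝ (Fin N)) :
    0 ≤ fracLaplacianSymbol s ξ :=
  Real.rpow_nonneg (by have := Real.pi_pos; positivity) _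

lemma continuous_fracLaplacianSymbol (hs : 0 < s) :
    Continuous (fracLaplacianSymbol s : EuclideanSpace ℝ (Fin N) → ℝ) :=
  Continuous.rpow_const (by fun_prop) fun _ => Or.inr (by linarith)

lemma continuous_heatMultiplier (hs : 0 < s) (t : ℝ) :
    Continuous (heatMultiplier s t : EuclideanSpace ℝ (Fin N) → ℝ) :=
  ((continuous_fracLaplacianSymbol hs).const_mul _).rexp

lemma heatMultiplier_pos (s t : ℝ) (ξ : EuclideanSpace ℝ (Fin N)) : 0 < heatMultiplier s t ξ :=
  Real.exp_pos _

lemma heatMultiplier_neg (s t : ℝ) (ξ : EuclideanSpace ℝ (Fin N)) :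
    heatMultiplier s t (-ξ) = heatMultiplier s t ξ := by
  simp [heatMultiplier, fracLaplacianSymbol]

lemma heatMultiplier_zero (hs : 0 < s) (t : ℝ) :
    heatMultiplier s t (0 : EuclideanSpace ℝ (Fin N)) = 1 := by
  simp [heatMultiplier, fracLaplacianSymbol, Real.zero_rpow (by linarith : 2 * s ≠ 0)]

lemma integrable_heatMultiplier [NeZero N] (hs : 0 < s) {t : ℝ} (ht : 0 < t) :
    Integrable (heatMultiplier s t : EuclideanSpace ℝ (Fin N) → ℝ) := by
  have : Nontrivial (EuclideanSpace ℝ (Fin N)) :=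
    Module.nontrivial_of_finrank_pos (R := ℝ) (by simpa using NeZero.pos N)
  have h := integrable_exp_neg_mul_norm_rpow (V := EuclideanSpace ℝ (Fin N))
    (b := t * (2 * Real.pi) ^ (2 * s)) (p := 2 * s) (by positivity) (by linarith)
  refine h.congr (.of_forall fun ξ => ?_)
  simp only [heatMultiplier, fracLaplacianSymbol]
  rw [Real.mul_rpow (by positivity) (norm_nonneg _)]
  ring_nf

lemma fracHeatProfile_eq [NeZero N] (hs : 0 < s) (x : EuclideanSpace ℝ (Fin N)) :
    fracHeatProfile s x = ((2 * Real.pi) ^ N)⁻¹ *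
      ∫ ξ : EuclideanSpace ℝ (Fin N), Real.cos (inner ℝ x ξ) * Real.exp (-‖ξ‖ ^ (2 * s)) := by
  have : Nontrivial (EuclideanSpace ℝ (Fin N)) :=
    Module.nontrivial_of_finrank_pos (R := ℝ) (by simpa using NeZero.pos N)
  have hb : Integrable fun ξ : EuclideanSpace ℝ (Fin N) => Real.exp (-‖ξ‖ ^ (2 * s)) := by
    simpa using integrable_exp_neg_mul_norm_rpow (V := EuclideanSpace ℝ (Fin N)) one_pos
      (by linarith : 0 < 2 * s)
  have hint : Integrable fun ξ : EuclideanSpace ℝ (Fin N) =>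
      Complex.exp (Complex.I * (inner ℝ x ξ : ℝ)) * (Real.exp (-‖ξ‖ ^ (2 * s)) : ℝ) := by
    refine hb.ofReal.bdd_mul (c := 1) (by fun_prop) (.of_forall fun ξ => ?_)
    rw [mul_comm, Complex.norm_exp_ofReal_mul_I]
  rw [fracHeatProfile]
  congr 1
  have h3 := integral_re hint
  simp only [RCLike.re_eq_complex_re] at h3
  rw [← h3]
  congr 1
  ext ξ
  rw [Complex.re_mul_ofReal, mul_comm Complex.I, Complex.exp_ofReal_mul_I_re]

lemma fracHeatKernel_eq [NeZero N] (hs : 0 < s) (x : EuclideanSpace ℝ (Fin N)) {t : ℝ}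
    (ht : 0 < t) : fracHeatKernel s x t =
      ∫ ξ : EuclideanSpace ℝ (Fin N), Real.cos (2 * Real.pi * inner ℝ x ξ) *
        heatMultiplier s t ξ := by
  -- The factor $2\pi$ reconciles the two Fourier normalisations and $t^{1/(2s)}$ is parabolic
  -- scaling. The Jacobian $R^{-N}$ supplies $(2\pi)^{-N}t^{-N/(2s)}$.
  set R : ℝ := 2 * Real.pi * t ^ (1 / (2 * s)) with hR
  have hRpos : 0 < R := by positivity
  have h1 := Measure.integral_comp_smul (volume : Measure (EuclideanSpace ℝ (Fin N)))
    (fun ξ => Real.cos (inner ℝ (t ^ (-1 / (2 * s)) • x) ξ) * Real.exp (-‖ξ‖ ^ (2 * s))) R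
  rw [fracHeatKernel, fracHeatProfile_eq hs]
  have h2 : ∀ ξ : EuclideanSpace ℝ (Fin N),
      Real.cos (inner ℝ (t ^ (-1 / (2 * s)) • x) (R • ξ)) * Real.exp (-‖R • ξ‖ ^ (2 * s)) =
      Real.cos (2 * Real.pi * inner ℝ x ξ) * heatMultiplier s t ξ := by
    intro ξ
    have e1 : t ^ (-1 / (2 * s)) * R = 2 * Real.pi := by
      rw [hR, mul_left_comm, ← Real.rpow_add ht]
      have : -1 / (2 * s) + 1 / (2 * s) = 0 := by ring
      rw [this, Real.rpow_zero, mul_one]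
    have e2 : ‖R • ξ‖ ^ (2 * s) = t * (2 * Real.pi * ‖ξ‖) ^ (2 * s) := by
      rw [norm_smul, Real.norm_of_nonneg hRpos.le, hR, mul_right_comm,
        Real.mul_rpow (by positivity) (by positivity), ← Real.rpow_mul ht.le]
      have : 1 / (2 * s) * (2 * s) = 1 := by field_simp
      rw [this, Real.rpow_one, mul_comm]
    rw [inner_smul_left, inner_smul_right, e2, heatMultiplier, fracLaplacianSymbol, ← mul_assoc,
      neg_mul]
    simp only [conj_trivial]
    rw [e1]
  simp_rw [h2] at h1
  rw [h1, finrank_euclideanSpace_fin, abs_of_pos (by positivity), smul_eq_mul, ← mul_assoc]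
  congr 1
  rw [hR, mul_pow (2 * Real.pi), mul_inv ((2 * Real.pi) ^ N), ← Real.rpow_natCast (t ^ (1 / (2 * s))), ← Real.rpow_mul ht.le,
    ← Real.rpow_neg ht.le, mul_comm]
  congr 2
  ring

lemma fourier_heatMultiplier [NeZero N] (hs : 0 < s) {t : ℝ} (ht : 0 < t)
    (x : EuclideanSpace ℝ (Fin N)) :
    𝓕 (fun ξ => (heatMultiplier s t ξ : ℂ)) x = fracHeatKernel s x t := by
  have hh := (integrable_heatMultiplier (N := N) hs ht)
  have hint : Integrable fun ξ : EuclideanSpace ℝ (Fin N) =>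
      Complex.exp (((-2 * Real.pi * inner ℝ ξ x : ℝ) : ℂ) * Complex.I) •
        (heatMultiplier s t ξ : ℂ) := by
    refine hh.ofReal.bdd_mul (c := 1) (by fun_prop) (.of_forall fun ξ => ?_)
    rw [Complex.norm_exp_ofReal_mul_I]
  rw [Real.fourier_eq', fracHeatKernel_eq hs x ht]
  apply Complex.ext
  · have h3 := integral_re hint
    simp only [RCLike.re_eq_complex_re] at h3
    rw [← h3, Complex.ofReal_re]
    congr 1
    ext ξ
    rw [smul_eq_mul, Complex.re_mul_ofReal, Complex.exp_ofReal_mul_I_re, neg_mul, neg_mul,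
      Real.cos_neg, real_inner_comm]
  -- The imaginary part is odd in $\xi$, because the multiplier is even, and so integrates to zero.
  · have h3 := integral_im hint
    simp only [RCLike.im_eq_complex_im] at h3
    rw [← h3, Complex.ofReal_im]
    have h4 := integral_neg_eq_self (μ := volume) (fun ξ : EuclideanSpace ℝ (Fin N) =>
      (Complex.exp (((-2 * Real.pi * inner ℝ ξ x : ℝ) : ℂ) * Complex.I) •
        (heatMultiplier s t ξ : ℂ)).im)
    have h5 : ∀ ξ : EuclideanSpace ℝ (Fin N),
        (Complex.exp (((-2 * Real.pi * inner ℝ (-ξ) x : ℝ) : ℂ) * Complex.I) •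
          (heatMultiplier s t (-ξ) : ℂ)).im =
        -(Complex.exp (((-2 * Real.pi * inner ℝ ξ x : ℝ) : ℂ) * Complex.I) •
          (heatMultiplier s t ξ : ℂ)).im := by
      intro ξ
      rw [smul_eq_mul, smul_eq_mul, Complex.im_mul_ofReal, Complex.im_mul_ofReal,
        Complex.exp_ofReal_mul_I_im, Complex.exp_ofReal_mul_I_im, heatMultiplier_neg,
        inner_neg_left, mul_neg, Real.sin_neg, neg_mul]
    simp_rw [h5] at h4
    rw [integral_neg] at h4
    linarith

lemma fracHeatProfile_nonneg [NeZero N] (hs0 : 0 < s) (hs1 : s < 1)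
    (x : EuclideanSpace ℝ (Fin N)) : 0 ≤ fracHeatProfile s x := by
  have : Nontrivial (EuclideanSpace ℝ (Fin N)) :=
    Module.nontrivial_of_finrank_pos (R := ℝ) (by simpa using NeZero.pos N)
  rw [fracHeatProfile_eq hs0]
  exact mul_nonneg (by positivity) (integral_cos_mul_exp_neg_norm_rpow_nonneg hs0 hs1 x)

lemma fracHeatKernel_nonneg [NeZero N] (hs0 : 0 < s) (hs1 : s < 1)
    (x : EuclideanSpace ℝ (Fin N)) {t : ℝ} (ht : 0 < t) : 0 ≤ fracHeatKernel s x t :=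
  mul_nonneg (Real.rpow_nonneg ht.le _) (fracHeatProfile_nonneg hs0 hs1 _)

lemma fracHeatProfile_eq_kernel (x : EuclideanSpace ℝ (Fin N)) :
    fracHeatProfile s x = fracHeatKernel s x 1 := by
  simp [fracHeatKernel]

lemma continuous_fracHeatKernel [NeZero N] (hs : 0 < s) {t : ℝ} (ht : 0 < t) :
    Continuous fun x : EuclideanSpace ℝ (Fin N) => fracHeatKernel s x t := by
  have h := Complex.continuous_re.comp (continuous_fourier_of_integrable
    (integrable_heatMultiplier (N := N) hs ht).ofReal)
  refine h.congr fun x => ?_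
  have := fourier_heatMultiplier hs ht x
  simp only [Function.comp_apply]
  exact (congrArg Complex.re this).trans (Complex.ofReal_re _)

lemma continuous_fracHeatProfile [NeZero N] (hs : 0 < s) :
    Continuous fun x : EuclideanSpace ℝ (Fin N) => fracHeatProfile s x := by
  simp_rw [fracHeatProfile_eq_kernel]
  exact continuous_fracHeatKernel hs one_pos

/-- Positivity replaces any decay estimate in space: the kernel is the nonnegative Fourier transform
of a continuous integrable function. -/
lemma integrable_fracHeatKernel [NeZero N] (hs0 : 0 < s) (hs1 : s < 1) {t : ℝ} (ht : 0 < t) :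
    Integrable fun x : EuclideanSpace ℝ (Fin N) => fracHeatKernel s x t :=
  integrable_fourier_of_nonneg
    (Complex.continuous_ofReal.comp (continuous_heatMultiplier hs0 t))
    (integrable_heatMultiplier hs0 ht).ofReal (fourier_heatMultiplier hs0 ht)
    (fun x => fracHeatKernel_nonneg hs0 hs1 x ht)

/-- Fourier inversion at frequency 0, where the multiplier equals 1. -/
lemma integral_fracHeatKernel [NeZero N] (hs0 : 0 < s) (hs1 : s < 1) {t : ℝ} (ht : 0 < t) :
    ∫ x : EuclideanSpace ℝ (Fin N), fracHeatKernel s x t = 1 := by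
  have heq : 𝓕 (fun ξ : EuclideanSpace ℝ (Fin N) => (heatMultiplier s t ξ : ℂ)) =
      fun x => (fracHeatKernel s x t : ℂ) := funext (fourier_heatMultiplier hs0 ht)
  have h := congrFun (Continuous.fourierInv_fourier_eq
    (f := fun ξ : EuclideanSpace ℝ (Fin N) => (heatMultiplier s t ξ : ℂ))
    (Complex.continuous_ofReal.comp (continuous_heatMultiplier hs0 t))
    (integrable_heatMultiplier hs0 ht).ofReal
    (by rw [heq]; exact (integrable_fracHeatKernel hs0 hs1 ht).ofReal)) 0
  rw [heq, Real.fourierInv_eq'] at h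
  simp only [inner_zero_right, mul_zero, Complex.ofReal_zero, zero_mul, Complex.exp_zero,
    one_smul, heatMultiplier_zero hs0] at h
  rw [integral_complex_ofReal] at h
  exact_mod_cast h

lemma fracHeatProfile_zero_pos [NeZero N] (hs : 0 < s) :
    0 < fracHeatProfile s (0 : EuclideanSpace ℝ (Fin N)) := by
  rw [fracHeatProfile_eq_kernel, fracHeatKernel_eq hs 0 one_pos]
  simp only [inner_zero_left, mul_zero, Real.cos_zero, one_mul]
  rw [integral_pos_iff_support_of_nonneg (fun ξ => (heatMultiplier_pos s 1 ξ).le)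
    (integrable_heatMultiplier hs one_pos)]
  have : Function.support (heatMultiplier s 1 : EuclideanSpace ℝ (Fin N) → ℝ) = univ :=
    eq_univ_of_forall fun ξ => (heatMultiplier_pos s 1 ξ).ne'
  rw [this]
  exact Measure.measure_univ_pos.2 (NeZero.ne _)

/-- The kernel is largest at the origin, as $\cos\le1$ against a positive multiplier. This gives the
decay $t^{-N/(2s)}$. -/
lemma fracHeatKernel_le [NeZero N] (hs : 0 < s) (x : EuclideanSpace ℝ (Fin N)) {t : ℝ}
    (ht : 0 < t) : fracHeatKernel s x t ≤
      t ^ (-(N : ℝ) / (2 * s)) * fracHeatProfile s (0 : EuclideanSpace ℝ (Fin N)) := by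
  refine mul_le_mul_of_nonneg_left ?_ (Real.rpow_nonneg ht.le _)
  rw [fracHeatProfile_eq_kernel, fracHeatProfile_eq_kernel, fracHeatKernel_eq hs _ one_pos,
    fracHeatKernel_eq hs _ one_pos]
  have hh := integrable_heatMultiplier (N := N) hs one_pos
  have hb : ∀ y : EuclideanSpace ℝ (Fin N), Integrable fun ξ : EuclideanSpace ℝ (Fin N) =>
      Real.cos (2 * Real.pi * inner ℝ y ξ) * heatMultiplier s 1 ξ := fun y =>
    hh.bdd_mul (c := 1) (by fun_prop) (.of_forall fun ξ => Real.abs_cos_le_one _)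
  refine integral_mono (hb _) (hb _) fun ξ => ?_
  simp only [inner_zero_left, mul_zero, Real.cos_zero]
  exact mul_le_mul_of_nonneg_right (Real.cos_le_one _) (heatMultiplier_pos s 1 ξ).le

end Kernel

/-! ### Continuity of translations in the integral norm -/

section Translation

variable {G : Type*} [NormedAddCommGroup G] [NormedSpace ℝ G] [FiniteDimensional ℝ G]
  [MeasurableSpace G] [BorelSpace G] {μ : Measure G} [μ.IsAddHaarMeasure]

set_option linter.unusedSectionVars false

/-- The `L¹` distance between an integrable function and its translates is continuous. -/
lemma continuous_integral_translate_sub {φ : G → ℝ} (hφ : Integrable φ μ) :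
    Continuous fun y => ∫ x, |φ (x - y) - φ x| ∂μ := by
  have hc : Continuous fun y : G => ‖(DomAddAct.mk (-y) +ᵥ hφ.toL1 φ : Lp ℝ 1 μ) - hφ.toL1 φ‖ := by
    have : Fact ((1 : ℝ≥0∞) ≠ ∞) := ⟨ENNReal.one_ne_top⟩
    have h : Continuous fun y : G => (DomAddAct.mk (-y) +ᵥ hφ.toL1 φ : Lp ℝ 1 μ) :=
      (DomAddAct.continuous_mk.comp continuous_neg).vadd continuous_const
    exact (h.sub continuous_const).norm
  refine hc.congr fun y => ?_
  have hy : Integrable (fun x => φ (x - y)) μ := hφ.comp_sub_right y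
  have h1 : (DomAddAct.mk (-y) +ᵥ hφ.toL1 φ : Lp ℝ 1 μ) = hy.toL1 (fun x => φ (x - y)) := by
    refine (DomAddAct.mk_vadd_toLp (-y) (memLp_one_iff_integrable.2 hφ)).trans ?_
    rw [Integrable.toL1]
    congr 1
    ext x
    simp [vadd_eq_add, sub_eq_neg_add]
  rw [h1, ← Integrable.toL1_sub _ _ hy hφ, L1.norm_of_fun_eq_integral_norm]
  rfl

lemma integral_translate_sub_le {φ : G → ℝ} (hφ : Integrable φ μ) (y : G) :
    ∫ x, |φ (x - y) - φ x| ∂μ ≤ 2 * ∫ x, |φ x| ∂μ := by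
  have hy : Integrable (fun x => φ (x - y)) μ := hφ.comp_sub_right y
  calc ∫ x, |φ (x - y) - φ x| ∂μ ≤ ∫ x, (|φ (x - y)| + |φ x|) ∂μ :=
        integral_mono (hy.sub hφ).abs (hy.abs.add hφ.abs) fun x => abs_sub _ _
    _ = 2 * ∫ x, |φ x| ∂μ := by
        rw [integral_add hy.abs hφ.abs, integral_sub_right_eq_self (fun x => |φ x|)]
        ring

end Translation

/-! ### Existence and uniqueness for the heat equation -/

section Heat

set_option linter.unusedSectionVars false

variable {N : ℕ} [NeZero N] {s : ℝ} {φ : EuclideanSpace ℝ (Fin N) → ℝ}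

lemma fracHeatKernel_neg (hs : 0 < s) (x : EuclideanSpace ℝ (Fin N)) {t : ℝ} (ht : 0 < t) :
    fracHeatKernel s (-x) t = fracHeatKernel s x t := by
  simp [fracHeatKernel_eq hs _ ht]

lemma norm_fourier_le {f : EuclideanSpace ℝ (Fin N) → ℂ} (ξ : EuclideanSpace ℝ (Fin N)) :
    ‖𝓕 f ξ‖ ≤ ∫ x, ‖f x‖ :=
  VectorFourier.norm_fourierIntegral_le_integral_norm Real.fourierChar volume (innerₗ _) f ξ

lemma integrable_heatMultiplier_mul_fourier (hs : 0 < s) (hφ : Integrable φ) {t : ℝ}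
    (ht : 0 < t) :
    Integrable fun ξ => (heatMultiplier s t ξ : ℂ) * 𝓕 (fun x => (φ x : ℂ)) ξ :=
  (integrable_heatMultiplier hs ht).ofReal.mul_bdd (c := ∫ x, ‖(φ x : ℂ)‖)
    (continuous_fourier_of_integrable hφ.ofReal).aestronglyMeasurable
    (.of_forall fun ξ => norm_fourier_le ξ)

lemma continuous_heatMultiplier_mul_fourier (hs : 0 < s) (hφ : Integrable φ) (t : ℝ) :
    Continuous fun ξ => (heatMultiplier s t ξ : ℂ) * 𝓕 (fun x => (φ x : ℂ)) ξ :=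
  (Complex.continuous_ofReal.comp (continuous_heatMultiplier hs t)).mul
    (continuous_fourier_of_integrable hφ.ofReal)

/-- The multiplication formula $\int\hat g\,\varphi=\int g\,\hat\varphi$, with `g` the multiplier
modulated by $e^{2\pi i\langle\xi,x\rangle}$, whose transform is the kernel centred at $x$. -/
lemma fracHeat_eq_fourierInv (hs : 0 < s) (hφ : Integrable φ) {t : ℝ} (ht : 0 < t)
    (x : EuclideanSpace ℝ (Fin N)) : (fracHeat s φ x t : ℂ) =
      𝓕⁻ (fun ξ => (heatMultiplier s t ξ : ℂ) * 𝓕 (fun x => (φ x : ℂ)) ξ) x := by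
  set g : EuclideanSpace ℝ (Fin N) → ℂ := fun ξ =>
    Real.fourierChar (inner ℝ ξ x) • (heatMultiplier s t ξ : ℂ) with hg
  have hgi : Integrable g := by
    refine (integrable_heatMultiplier (N := N) hs ht).ofReal.norm.mono' ?_
      (.of_forall fun ξ => by simp only [hg, Circle.norm_smul]; rfl)
    refine Continuous.aestronglyMeasurable ?_
    exact (Real.continuous_fourierChar.comp (by fun_prop)).smul
      (Complex.continuous_ofReal.comp (continuous_heatMultiplier hs t))
  have h1 : ∀ y, 𝓕 g y = fracHeatKernel s (x - y) t := by
    intro y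
    rw [← neg_sub y x, fracHeatKernel_neg hs _ ht, ← fourier_heatMultiplier hs ht, Real.fourier_eq,
      Real.fourier_eq]
    congr 1
    ext ξ
    simp only [hg]
    rw [smul_smul, ← AddChar.map_add_eq_mul, inner_sub_right]
    congr 2
    ring
  have h2 := VectorFourier.integral_fourierIntegral_smul_eq_flip
    (L := innerₗ (EuclideanSpace ℝ (Fin N))) Real.continuous_fourierChar continuous_inner hgi
    hφ.ofReal (𝕜 := ℝ) (F := ℂ)
  have h3 : ∀ y, VectorFourier.fourierIntegral Real.fourierChar volume
      (innerₗ (EuclideanSpace ℝ (Fin N))) g y = fracHeatKernel s (x - y) t := h1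
  have h4 : ∀ ξ, VectorFourier.fourierIntegral Real.fourierChar volume
      (innerₗ (EuclideanSpace ℝ (Fin N))).flip (fun x => (φ x : ℂ)) ξ =
      𝓕 (fun x => (φ x : ℂ)) ξ := by
    intro ξ; rw [flip_innerₗ]; rfl
  rw [fracHeat, ← integral_complex_ofReal, Real.fourierInv_eq]
  refine Eq.trans ?_ (h2.trans ?_)
  · congr 1
    ext y
    rw [h3, smul_eq_mul]
    push_cast
    rfl
  · congr 1
    ext ξ
    refine (congrArg _ (h4 ξ)).trans ?_
    simp only [hg, smul_mul_assoc, smul_eq_mul]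

lemma integrable_fracHeat (hs0 : 0 < s) (hs1 : s < 1) (hφ : Integrable φ) {t : ℝ}
    (ht : 0 < t) : Integrable fun x => fracHeat s φ x t := by
  have h := hφ.integrable_convolution (ContinuousLinearMap.mul ℝ ℝ)
    (integrable_fracHeatKernel (N := N) hs0 hs1 ht)
  refine h.congr (.of_forall fun x => ?_)
  simp only [convolution, fracHeat, ContinuousLinearMap.mul_apply']
  congr 1
  ext y
  ring

lemma fourierInv_eq_fracHeat (hs : 0 < s) (hφ : Integrable φ) {t : ℝ} (ht : 0 < t) :
    𝓕⁻ (fun ξ => (heatMultiplier s t ξ : ℂ) * 𝓕 (fun x => (φ x : ℂ)) ξ) =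
      fun x => (fracHeat s φ x t : ℂ) :=
  funext fun x => (fracHeat_eq_fourierInv hs hφ ht x).symm

lemma continuous_fracHeat (hs : 0 < s) (hφ : Integrable φ) {t : ℝ} (ht : 0 < t) :
    Continuous fun x => fracHeat s φ x t := by
  have h1 := (continuous_fourier_of_integrable
    (integrable_heatMultiplier_mul_fourier hs hφ ht)).comp continuous_neg
  refine (Complex.continuous_re.comp h1).congr fun x => ?_
  simp only [Function.comp_apply]
  rw [← Real.fourierInv_eq_fourier_neg, ← fracHeat_eq_fourierInv hs hφ ht, Complex.ofReal_re]

lemma fourier_fracHeat (hs0 : 0 < s) (hs1 : s < 1) (hφ : Integrable φ) {t : ℝ} (ht : 0 < t) :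
    𝓕 (fun x => (fracHeat s φ x t : ℂ)) =
      fun ξ => (heatMultiplier s t ξ : ℂ) * 𝓕 (fun x => (φ x : ℂ)) ξ := by
  rw [← fourierInv_eq_fracHeat hs0 hφ ht]
  refine Continuous.fourier_fourierInv_eq (continuous_heatMultiplier_mul_fourier hs0 hφ t)
    (integrable_heatMultiplier_mul_fourier hs0 hφ ht) ?_
  -- Inversion needs the transform of the frequency-side function to be integrable; that transform
  -- is the reflection of `fracHeat`, an $L^1$ convolution.
  have h := (integrable_fracHeat hs0 hs1 hφ ht).ofReal (𝕜 := ℂ)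
  refine h.comp_neg.congr (.of_forall fun x => ?_)
  refine (fracHeat_eq_fourierInv hs0 hφ ht (-x)).trans ?_
  rw [Real.fourierInv_eq_fourier_neg, neg_neg]

/-- Unit mass writes the difference as $\int K(y)(\varphi(x-y)-\varphi(x))\,dy$; the rest is the
triangle inequality and Fubini. -/
lemma integral_abs_fracHeat_sub_le (hs0 : 0 < s) (hs1 : s < 1) (hφ : Integrable φ) {t : ℝ}
    (ht : 0 < t) : ∫ x, |fracHeat s φ x t - φ x| ≤
      ∫ y, fracHeatKernel s y t * ∫ x, |φ (x - y) - φ x| := by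
  have hK := integrable_fracHeatKernel (N := N) hs0 hs1 ht
  set F : EuclideanSpace ℝ (Fin N) × EuclideanSpace ℝ (Fin N) → ℝ := fun z =>
    fracHeatKernel s z.2 t * φ (z.1 - z.2) - φ z.1 * fracHeatKernel s z.2 t with hF
  have h1 : Integrable (fun z : EuclideanSpace ℝ (Fin N) × EuclideanSpace ℝ (Fin N) =>
      fracHeatKernel s z.2 t * φ (z.1 - z.2)) (volume.prod volume) :=
    hK.convolution_integrand (ContinuousLinearMap.mul ℝ ℝ) hφ
  have h2 : Integrable (fun z : EuclideanSpace ℝ (Fin N) × EuclideanSpace ℝ (Fin N) =>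
      φ z.1 * fracHeatKernel s z.2 t) (volume.prod volume) := hφ.mul_prod hK
  have hFi : Integrable F (volume.prod volume) := h1.sub h2
  have h3 : ∀ᵐ x, |fracHeat s φ x t - φ x| ≤ ∫ y, |F (x, y)| := by
    filter_upwards [h1.prod_right_ae, h2.prod_right_ae] with x hx1 hx2
    have : fracHeat s φ x t - φ x = ∫ y, F (x, y) := by
      simp only [hF]
      rw [integral_sub hx1 hx2, integral_const_mul, integral_fracHeatKernel hs0 hs1 ht, mul_one,
        fracHeat, ← integral_sub_left_eq_self _ _ x]
      simp
    rw [this]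
    exact norm_integral_le_integral_norm (μ := volume) fun y => F (x, y)
  calc ∫ x, |fracHeat s φ x t - φ x| ≤ ∫ x, ∫ y, |F (x, y)| :=
        integral_mono_ae ((integrable_fracHeat hs0 hs1 hφ ht).sub hφ).abs
          hFi.abs.integral_prod_left h3
    _ = ∫ y, ∫ x, |F (x, y)| := integral_integral_swap hFi.abs
    _ = ∫ y, fracHeatKernel s y t * ∫ x, |φ (x - y) - φ x| := by
        congr 1
        ext y
        rw [← integral_const_mul]
        congr 1
        ext x
        simp only [hF]
        rw [mul_comm (φ x), ← mul_sub, abs_mul, abs_of_nonneg (fracHeatKernel_nonneg hs0 hs1 y ht)]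

/-- Substituting $y=t^{1/(2s)}z$ moves all dependence on time into the argument of `w`, ready for
dominated convergence as $t\to0$. -/
lemma integral_fracHeatKernel_mul (w : EuclideanSpace ℝ (Fin N) → ℝ) {t : ℝ}
    (ht : 0 < t) : ∫ y, fracHeatKernel s y t * w y =
      ∫ z, fracHeatProfile s z * w (t ^ (1 / (2 * s)) • z) := by
  have hR : 0 < t ^ (1 / (2 * s)) := by positivity
  have h1 := Measure.integral_comp_smul (volume : Measure (EuclideanSpace ℝ (Fin N)))
    (fun y => fracHeatProfile s (t ^ (-1 / (2 * s)) • y) * w y) (t ^ (1 / (2 * s)))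
  have h2 : t ^ (-1 / (2 * s)) * t ^ (1 / (2 * s)) = 1 := by
    rw [← Real.rpow_add ht]
    have : -1 / (2 * s) + 1 / (2 * s) = 0 := by ring
    rw [this, Real.rpow_zero]
  simp only [smul_smul, h2, one_smul] at h1
  rw [h1, finrank_euclideanSpace_fin, abs_of_pos (by positivity), smul_eq_mul,
    ← integral_const_mul]
  congr 1
  ext y
  rw [fracHeatKernel, ← Real.rpow_natCast, ← Real.rpow_mul ht.le, ← Real.rpow_neg ht.le, mul_assoc]
  congr 2
  ring

lemma tendsto_integral_abs_fracHeat_sub (hs0 : 0 < s) (hs1 : s < 1) (hφ : Integrable φ) :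
    Tendsto (fun t : ℝ => ∫ x, |fracHeat s φ x t - φ x|) (𝓝[>] 0) (𝓝 0) := by
  have hω := continuous_integral_translate_sub hφ
  set ω := fun y => ∫ x, |φ (x - y) - φ x| with hωdef
  have hω0 : ω 0 = 0 := by simp [hωdef]
  have hP : Integrable fun z : EuclideanSpace ℝ (Fin N) => fracHeatProfile s z := by
    simp_rw [fracHeatProfile_eq_kernel]
    exact integrable_fracHeatKernel hs0 hs1 one_pos
  have hlim : Tendsto (fun t : ℝ => ∫ z, fracHeatProfile s z * ω (t ^ (1 / (2 * s)) • z))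
      (𝓝[>] 0) (𝓝 (∫ z : EuclideanSpace ℝ (Fin N), fracHeatProfile s z * ω 0)) := by
    refine tendsto_integral_filter_of_dominated_convergence
      (fun z => fracHeatProfile s z * (2 * ∫ x, |φ x|)) (.of_forall fun t => ?_)
      (.of_forall fun t => .of_forall fun z => ?_) (hP.mul_const _) (.of_forall fun z => ?_)
    · exact ((continuous_fracHeatProfile hs0).mul
        (hω.comp (continuous_const_smul _))).aestronglyMeasurable
    · rw [norm_mul, Real.norm_of_nonneg (fracHeatProfile_nonneg hs0 hs1 z), Real.norm_of_nonneg
        (integral_nonneg fun _ => abs_nonneg _)]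
      exact mul_le_mul_of_nonneg_left (integral_translate_sub_le hφ _)
        (fracHeatProfile_nonneg hs0 hs1 z)
    · refine Tendsto.const_mul _ ((hω.tendsto 0).comp ?_)
      have h1 : Tendsto (fun t : ℝ => t ^ (1 / (2 * s))) (𝓝[>] 0) (𝓝 0) := by
        have : ContinuousAt (fun t : ℝ => t ^ (1 / (2 * s))) 0 :=
          Real.continuousAt_rpow_const _ _ (Or.inr (by positivity))
        have h2 := this.tendsto
        rw [Real.zero_rpow (by positivity)] at h2
        exact h2.mono_left nhdsWithin_le_nhds
      simpa using h1.smul_const z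
  simp only [hω0, mul_zero, integral_zero] at hlim
  refine squeeze_zero' (.of_forall fun t => integral_nonneg fun _ => abs_nonneg _) ?_ hlim
  filter_upwards [self_mem_nhdsWithin] with t ht
  exact (integral_abs_fracHeat_sub_le hs0 hs1 hφ ht).trans
    (integral_fracHeatKernel_mul ω ht).le

/-- The fractional heat semigroup solves the fractional heat equation. -/
theorem isFracHeatSolution_fracHeat (hs0 : 0 < s) (hs1 : s < 1) (hφ : Integrable φ) :
    IsFracHeatSolution s φ (fracHeat s φ) where
  continuous _ ht := continuous_fracHeat hs0 hφ ht
  integrable _ ht := integrable_fracHeat hs0 hs1 hφ ht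
  equation t ht ξ := by
    have h1 : HasDerivAt (fun r : ℝ => -r * fracLaplacianSymbol s ξ)
        (-1 * fracLaplacianSymbol s ξ) t := (hasDerivAt_id t).neg.mul_const _
    have h2 := (h1.exp.ofReal_comp).mul_const (𝓕 (fun x => (φ x : ℂ)) ξ)
    rw [fourier_fracHeat hs0 hs1 hφ ht]
    have h3 : (fun r : ℝ => 𝓕 (fun x => (fracHeat s φ x r : ℂ)) ξ) =ᶠ[𝓝 t]
        fun r : ℝ => ((Real.exp (-r * fracLaplacianSymbol s ξ) : ℝ) : ℂ) *
          𝓕 (fun x => (φ x : ℂ)) ξ := by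
      filter_upwards [eventually_gt_nhds ht] with r hr
      rw [fourier_fracHeat hs0 hs1 hφ hr]
      rfl
    refine (h2.congr_of_eventuallyEq h3).congr_deriv ?_
    simp only [heatMultiplier]
    push_cast
    ring
  initial := tendsto_integral_abs_fracHeat_sub hs0 hs1 hφ

/-- Solutions of the fractional heat equation are unique. -/
theorem IsFracHeatSolution.eq_fracHeat {v : EuclideanSpace ℝ (Fin N) → ℝ → ℝ}
    (hv : IsFracHeatSolution s φ v) (hs : 0 < s) (hφ : Integrable φ) {t : ℝ} (ht : 0 < t)
    (x : EuclideanSpace ℝ (Fin N)) : v x t = fracHeat s φ x t := by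
  have hF : ∀ ξ, 𝓕 (fun x => (v x t : ℂ)) ξ =
      (heatMultiplier s t ξ : ℂ) * 𝓕 (fun x => (φ x : ℂ)) ξ := by
    intro ξ
    set a := fracLaplacianSymbol s ξ with ha
    -- Integrating factor: the equation at frequency $\xi$ makes `W` constant on $(0,\infty)$, and
    -- its limit at 0 identifies the constant.
    set W : ℝ → ℂ := fun r => Complex.exp ((r * a : ℝ) : ℂ) * 𝓕 (fun x => (v x r : ℂ)) ξ with hW
    have hWd : ∀ r ∈ Ioi (0 : ℝ), HasDerivAt W 0 r := by
      intro r hr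
      have h1 : HasDerivAt (fun r : ℝ => r * a) (1 * a) r := (hasDerivAt_id r).mul_const _
      refine (h1.ofReal_comp.cexp.mul (hv.equation r hr ξ)).congr_deriv ?_
      push_cast
      ring
    have hconst : ∀ r ∈ Ioi (0 : ℝ), W r = W t := fun r hr =>
      isOpen_Ioi.is_const_of_deriv_eq_zero isPreconnected_Ioi
        (fun r hr => (hWd r hr).differentiableAt.differentiableWithinAt)
        (fun r hr => (hWd r hr).deriv) hr ht
    -- Convergence in $L^1$ implies convergence of the Fourier transforms at each frequency.
    have hlim1 : Tendsto (fun r : ℝ => 𝓕 (fun x => (v x r : ℂ)) ξ) (𝓝[>] 0)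
        (𝓝 (𝓕 (fun x => (φ x : ℂ)) ξ)) := by
      rw [tendsto_iff_norm_sub_tendsto_zero]
      refine squeeze_zero' (.of_forall fun _ => norm_nonneg _) ?_ hv.initial
      filter_upwards [self_mem_nhdsWithin] with r hr
      have hvi : Integrable fun x => (v x r : ℂ) := (hv.integrable r hr).ofReal
      have hφi : Integrable fun x => (φ x : ℂ) := hφ.ofReal
      have hsub : 𝓕 (fun x => (v x r : ℂ)) ξ - 𝓕 (fun x => (φ x : ℂ)) ξ =
          𝓕 (fun x => ((v x r - φ x : ℝ) : ℂ)) ξ := by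
        rw [Real.fourier_eq, Real.fourier_eq, Real.fourier_eq, ← integral_sub
          ((Real.fourierIntegral_convergent_iff ξ).2 hvi)
          ((Real.fourierIntegral_convergent_iff ξ).2 hφi)]
        congr 1
        ext y
        rw [← smul_sub, Complex.ofReal_sub]
      rw [hsub]
      refine (norm_fourier_le ξ).trans (le_of_eq ?_)
      simp only [Complex.norm_real, Real.norm_eq_abs]
    have hlim2 : Tendsto W (𝓝[>] 0) (𝓝 (𝓕 (fun x => (φ x : ℂ)) ξ)) := by
      have h1 : Continuous fun r : ℝ => Complex.exp ((r * a : ℝ) : ℂ) := by fun_prop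
      have h2 := ((h1.tendsto 0).mono_left (nhdsWithin_le_nhds (s := Ioi 0))).mul hlim1
      simpa [hW] using h2
    have hWt : W t = 𝓕 (fun x => (φ x : ℂ)) ξ := by
      refine tendsto_nhds_unique (Tendsto.congr' ?_ tendsto_const_nhds) hlim2
      filter_upwards [self_mem_nhdsWithin] with r hr using (hconst r hr).symm
    rw [← hWt, hW, heatMultiplier, ← ha, ← mul_assoc, Complex.ofReal_exp, ← Complex.exp_add]
    push_cast
    simp
  have hF' : 𝓕 (fun x => (v x t : ℂ)) =
      fun ξ => (heatMultiplier s t ξ : ℂ) * 𝓕 (fun x => (φ x : ℂ)) ξ := funext hF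
  -- The transform is integrable thanks to the multiplier, and $v(\cdot,t)$ is continuous, so
  -- inversion gives equality at every point, not merely almost everywhere.
  have h1 := Continuous.fourierInv_fourier_eq
    (Complex.continuous_ofReal.comp (hv.continuous t ht)) (hv.integrable t ht).ofReal
    (by
      have := integrable_heatMultiplier_mul_fourier hs hφ ht
      rw [← hF'] at this
      exact this)
  have h2 : 𝓕⁻ (𝓕 (fun x => (v x t : ℂ))) x = (v x t : ℂ) := congrFun h1 x
  rw [hF', ← fracHeat_eq_fourierInv hs hφ ht] at h2
  exact_mod_cast h2.symm

end Heat

/-! ### Positivity and integrability in time -/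

section HeatInTime

set_option linter.unusedSectionVars false

variable {N : ℕ} [NeZero N] {s : ℝ} {φ : EuclideanSpace ℝ (Fin N) → ℝ}

lemma fracHeat_nonneg (hs0 : 0 < s) (hs1 : s < 1) (hφ0 : ∀ᵐ x, 0 ≤ φ x)
    (x : EuclideanSpace ℝ (Fin N)) {t : ℝ} (ht : 0 < t) : 0 ≤ fracHeat s φ x t :=
  integral_nonneg_of_ae (hφ0.mono fun _ hy => mul_nonneg (fracHeatKernel_nonneg hs0 hs1 _ ht) hy)

lemma abs_fracHeat_le_of_bound (hs0 : 0 < s) (hs1 : s < 1) {M : ℝ} (hM : ∀ᵐ x, |φ x| ≤ M)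
    (x : EuclideanSpace ℝ (Fin N)) {t : ℝ} (ht : 0 < t) : |fracHeat s φ x t| ≤ M := by
  have hK := (integrable_fracHeatKernel (N := N) hs0 hs1 ht).comp_sub_left x
  have h1 : |fracHeat s φ x t| ≤ ∫ y, fracHeatKernel s (x - y) t * M := by
    refine norm_integral_le_of_norm_le (f := fun y => fracHeatKernel s (x - y) t * φ y)
      (hK.mul_const M) ?_
    filter_upwards [hM] with y hy
    rw [norm_mul, Real.norm_of_nonneg (fracHeatKernel_nonneg hs0 hs1 _ ht)]
    exact mul_le_mul_of_nonneg_left hy (fracHeatKernel_nonneg hs0 hs1 _ ht)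
  rwa [integral_mul_const, integral_sub_left_eq_self (fun y => fracHeatKernel s y t),
    integral_fracHeatKernel hs0 hs1 ht, one_mul] at h1

lemma abs_fracHeat_le_rpow (hs0 : 0 < s) (hs1 : s < 1) (hφ : Integrable φ)
    (x : EuclideanSpace ℝ (Fin N)) {t : ℝ} (ht : 0 < t) : |fracHeat s φ x t| ≤
      t ^ (-(N : ℝ) / (2 * s)) * (fracHeatProfile s (0 : EuclideanSpace ℝ (Fin N)) *
        ∫ y, |φ y|) := by
  rw [← mul_assoc, ← integral_const_mul]
  refine norm_integral_le_of_norm_le (f := fun y => fracHeatKernel s (x - y) t * φ y)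
    (hφ.abs.const_mul _) (.of_forall fun y => ?_)
  rw [norm_mul, Real.norm_of_nonneg (fracHeatKernel_nonneg hs0 hs1 _ ht)]
  exact mul_le_mul_of_nonneg_right (fracHeatKernel_le hs0 _ ht) (abs_nonneg _)

lemma stronglyMeasurable_fracHeat (hs : 0 < s) (hφ : AEStronglyMeasurable φ)
    (x : EuclideanSpace ℝ (Fin N)) : StronglyMeasurable (fracHeat s φ x) := by
  have h1 : fracHeat s φ x = fun t => ∫ y, fracHeatKernel s (x - y) t * hφ.mk φ y := by
    ext t
    refine integral_congr_ae ?_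
    filter_upwards [hφ.ae_eq_mk] with y hy
    rw [← hy]
  have hP := (continuous_fracHeatProfile (N := N) hs).measurable
  have hφ' := hφ.stronglyMeasurable_mk.measurable
  have hm : Measurable fun z : ℝ × EuclideanSpace ℝ (Fin N) =>
      fracHeatKernel s (x - z.2) z.1 * hφ.mk φ z.2 := by
    unfold fracHeatKernel
    exact ((by fun_prop : Measurable fun z : ℝ × EuclideanSpace ℝ (Fin N) =>
      z.1 ^ (-(N : ℝ) / (2 * s))).mul (hP.comp (by fun_prop))).mul (hφ'.comp measurable_snd)
  rw [h1]
  exact hm.stronglyMeasurable.integral_prod_right'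

/-- On $(0,1]$ the solution is bounded by the bound on `φ`; beyond 1 it is dominated by
$t^{-N/(2s)}$, whose exponent is below $-1$ because $2s<N$. -/
lemma integrableOn_fracHeat (hs0 : 0 < s) (hs1 : s < 1) (hN : 2 * s < N) (hφ : Integrable φ)
    {M : ℝ} (hM : ∀ᵐ x, |φ x| ≤ M) (x : EuclideanSpace ℝ (Fin N)) :
    IntegrableOn (fracHeat s φ x) (Ioi 0) := by
  have hm := (stronglyMeasurable_fracHeat hs0 hφ.aestronglyMeasurable x).aestronglyMeasurable
    (μ := volume)
  rw [← Ioc_union_Ioi_eq_Ioi (zero_le_one' ℝ)]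
  refine IntegrableOn.union ?_ ?_
  · refine Measure.integrableOn_of_bounded (M := M) (by simp) hm ?_
    filter_upwards [ae_restrict_mem measurableSet_Ioc] with t ht
    exact abs_fracHeat_le_of_bound hs0 hs1 hM x ht.1
  · have hexp : -(N : ℝ) / (2 * s) < -1 := by
      rw [div_lt_iff₀ (by linarith)]
      linarith
    refine ((integrableOn_Ioi_rpow_of_lt hexp one_pos).mul_const
      (fracHeatProfile s (0 : EuclideanSpace ℝ (Fin N)) * ∫ y, |φ y|)).mono' hm.restrict ?_
    filter_upwards [ae_restrict_mem measurableSet_Ioi] with t ht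
    exact abs_fracHeat_le_rpow hs0 hs1 hφ x (one_pos.trans ht)

/-- Positivity of the profile near the origin suffices: for large $t$ the points $t^{-1/(2s)}(x-y)$,
with $y$ in a fixed ball where `φ` has mass, all fall into that neighbourhood. -/
lemma integral_fracHeat_pos (hs0 : 0 < s) (hs1 : s < 1) (hφ : Integrable φ)
    (hφ0 : ∀ᵐ x, 0 ≤ φ x) (hφne : ¬ φ =ᵐ[volume] 0) (x : EuclideanSpace ℝ (Fin N))
    (hint : IntegrableOn (fracHeat s φ x) (Ioi 0)) : 0 < ∫ t in Ioi 0, fracHeat s φ x t := by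
  obtain ⟨δ, hδ, hball⟩ : ∃ δ > 0, ∀ z : EuclideanSpace ℝ (Fin N), ‖z‖ < δ →
      0 < fracHeatProfile s z := by
    have h1 := (continuous_fracHeatProfile (N := N) hs0).continuousAt.eventually_const_lt
      (fracHeatProfile_zero_pos hs0)
    obtain ⟨δ, hδ, h⟩ := Metric.eventually_nhds_iff.1 h1
    exact ⟨δ, hδ, fun z hz => h (by simpa using hz)⟩
  obtain ⟨n, hn⟩ : ∃ n : ℕ, 0 < volume (Function.support φ ∩ Metric.ball x n) := by
    by_contra! hall
    refine hφne ?_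
    have h1 : volume (⋃ n : ℕ, Function.support φ ∩ Metric.ball x n) = 0 :=
      measure_iUnion_null fun n => nonpos_iff_eq_zero.1 (hall n)
    rw [← inter_iUnion, Metric.iUnion_ball_nat, inter_univ] at h1
    exact measure_eq_zero_iff_ae_notMem.1 h1 |>.mono fun y hy => by simpa using hy
  have hlim : Tendsto (fun t : ℝ => t ^ (-1 / (2 * s)) * n) atTop (𝓝 0) := by
    have h1 := (tendsto_rpow_neg_atTop (y := 1 / (2 * s)) (by positivity)).mul_const (n : ℝ)
    rw [zero_mul] at h1
    refine h1.congr fun t => ?_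
    rw [neg_div]
  have hev : ∀ᶠ t in atTop, 0 < fracHeat s φ x t := by
    filter_upwards [hlim.eventually_lt_const hδ, eventually_gt_atTop 0] with t ht ht0
    have hKint : Integrable fun y => fracHeatKernel s (x - y) t * φ y := by
      refine hφ.bdd_mul (c := t ^ (-(N : ℝ) / (2 * s)) *
        fracHeatProfile s (0 : EuclideanSpace ℝ (Fin N)))
        ((continuous_fracHeatKernel hs0 ht0).comp (by fun_prop)).aestronglyMeasurable
        (.of_forall fun y => ?_)
      rw [Real.norm_of_nonneg (fracHeatKernel_nonneg hs0 hs1 _ ht0)]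
      exact fracHeatKernel_le hs0 _ ht0
    rw [fracHeat, integral_pos_iff_support_of_nonneg_ae (hφ0.mono fun y hy =>
      mul_nonneg (fracHeatKernel_nonneg hs0 hs1 _ ht0) hy) hKint]
    refine hn.trans_le (measure_mono fun y hy => mul_ne_zero ?_ hy.1)
    refine (mul_pos (Real.rpow_pos_of_pos ht0 _) (hball _ ?_)).ne'
    rw [norm_smul, Real.norm_of_nonneg (Real.rpow_nonneg ht0.le _)]
    refine lt_of_le_of_lt (mul_le_mul_of_nonneg_left ?_ (Real.rpow_nonneg ht0.le _)) ht
    have h1 := hy.2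
    rw [Metric.mem_ball, dist_comm, dist_eq_norm] at h1
    exact h1.le
  obtain ⟨T, hT⟩ := eventually_atTop.1 hev
  rw [setIntegral_pos_iff_support_of_nonneg_ae _ hint]
  · have hsub : Ioi (max T 0) ⊆ Function.support (fracHeat s φ x) ∩ Ioi 0 := fun t ht =>
      ⟨(hT t ((le_max_left _ _).trans (mem_Ioi.1 ht).le)).ne', mem_Ioi.2 ((le_max_right _ _).trans_lt (mem_Ioi.1 ht))⟩
    refine lt_of_lt_of_le ?_ (measure_mono hsub)
    simp
  · filter_upwards [ae_restrict_mem measurableSet_Ioi] with t ht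
    exact fracHeat_nonneg hs0 hs1 hφ0 x ht

end HeatInTime

/-! ### The theorem -/

theorem theorem1p4 {N : ℕ} {s : ℝ}
    (hNs : (2 ≤ N ∧ 0 < s ∧ s < 1) ∨ (N = 1 ∧ 0 < s ∧ s < 1 / 2))
    (φ : EuclideanSpace ℝ (Fin N) → ℝ)
    (hφ_nonneg : ∀ᵐ x, 0 ≤ φ x) (hφ_one : MemLp φ 1) (hφ_top : MemLp φ ∞) :
    IsFracHeatSolution s φ (fracHeat s φ) ∧
    ∀ v : EuclideanSpace ℝ (Fin N) → ℝ → ℝ, IsFracHeatSolution s φ v →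
      (∀ x, ∀ t > 0, v x t = fracHeat s φ x t) ∧
      (∀ x, ∀ t > 0, 0 ≤ v x t) ∧
      (∀ x, IntegrableOn (v x) (Ioi 0)) ∧
      ∀ {Ω : Type*} [MeasurableSpace Ω] (P : Measure Ω) [IsProbabilityMeasure P]
        (S : ℝ≥0 → Ω → ℝ) (σ : Measure ℝ) (ϱ : ℝ),
        IsSubordinator P S → IsSubordinatorLevyMeasure σ → HasLevyMeasure P S σ →
        Tendsto (fun p => p * laplaceTransform (tailKernel σ) p) (𝓝[>] 0) (𝓝 0) →
        0 ≤ ϱ →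
        IsSlowlyVarying (fun x => x ^ (-ϱ) * laplaceTransform (tailKernel σ) x⁻¹) →
        ¬ (φ =ᵐ[volume] 0) →
        ∀ x, Tendsto
          (fun t => cesaroMean (subordination P S (v x)) t /
            ((∫ τ in Ioi 0, |v x τ|) / Real.Gamma (ϱ + 1) *
              (t⁻¹ * laplaceTransform (tailKernel σ) t⁻¹)))
          atTop (𝓝 1) := by

  have hN : NeZero N := ⟨by rcases hNs with h | h <;> omega⟩
  have hs0 : 0 < s := by rcases hNs with h | h <;> exact h.2.1
  have hs1 : s < 1 := by rcases hNs with h | h <;> linarith [h.2.2]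
  -- Both alternatives on $N$ and $s$ enter only through $0<s<1$, $2s<N$ and $N\ne0$.
  have hNs' : 2 * s < N := by
    rcases hNs with h | h
    · have : (2 : ℝ) ≤ N := by exact_mod_cast h.1
      linarith
    · rw [h.1, Nat.cast_one]
      linarith [h.2.2]
  have hφ : Integrable φ := memLp_one_iff_integrable.1 hφ_one
  obtain ⟨M, hM⟩ : ∃ M, ∀ᵐ x, |φ x| ≤ M := by
    refine ⟨(eLpNormEssSup φ volume).toReal, ?_⟩
    have hfin := hφ_top.eLpNorm_lt_top
    rw [eLpNorm_exponent_top] at hfin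
    filter_upwards [enorm_ae_le_eLpNormEssSup φ volume] with x hx
    rw [← Real.norm_eq_abs, ← toReal_enorm]
    exact ENNReal.toReal_mono hfin.ne hx
  refine ⟨isFracHeatSolution_fracHeat hs0 hs1 hφ, fun v hv => ?_⟩
  have hveq : ∀ x, ∀ t > 0, v x t = fracHeat s φ x t := fun x t ht =>
    hv.eq_fracHeat hs0 hφ ht x
  have hv0 : ∀ x, ∀ t > 0, 0 ≤ v x t := fun x t ht => by
    rw [hveq x t ht]
    exact fracHeat_nonneg hs0 hs1 hφ_nonneg x ht
  have hvint : ∀ x, IntegrableOn (v x) (Ioi 0) := fun x =>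
    (integrableOn_fracHeat hs0 hs1 hNs' hφ hM x).congr_fun (fun t ht => (hveq x t ht).symm)
      measurableSet_Ioi
  refine ⟨hveq, hv0, hvint, ?_⟩
  intro Ω _ P _ S σ ϱ hS hσ hL hK hϱ hslow hφne x
  have habs : ∫ τ in Ioi 0, |v x τ| = ∫ τ in Ioi 0, v x τ :=
    setIntegral_congr_fun measurableSet_Ioi fun τ hτ => abs_of_nonneg (hv0 x τ hτ)
  rw [habs]
  refine tendsto_cesaroMean_subordination hS hσ hL hK hϱ hslow (hv0 x) (hvint x) ?_
  rw [setIntegral_congr_fun measurableSet_Ioi fun τ hτ => hveq x τ hτ]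
  exact integral_fracHeat_pos hs0 hs1 hφ hφ_nonneg hφne x
    (integrableOn_fracHeat hs0 hs1 hNs' hφ hM x)
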